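/- Let $\mathcal N_2$ be the variety of all nilpotent groups of class at most two (groups $G$ with $G'=[G,G]\subseteq Z(G)$), and let $\mathcal B_m$ be the variety of all groups satisfying $x^m=e$. An amalgam $(K_1,K_2;G)$ with core $G$ consists of groups $K_1,K_2,G$ with injective homomorphisms $\Phi_j\colon G\to K_j$ $(j=1,2)$; it is an amalgam of $\mathcal C$-groups if $K_1,K_2$ (and $G$) belong to $\mathcal C$. It is weakly embeddable in $\mathcal N_2$ if there are a group $M\in\mathcal N_2$ and injective homomorphisms $\lambda_j\colon K_j\to M$ with $\lambda_1\circ\Phi_1=\lambda_2\circ\Phi_2$; it is strongly embeddable in $\mathcal N_2$ if these can be chosen so that, in addition, $\lambda_1(a)\neq\lambda_2(c)$ for all $a\in K_1\setminus\Phi_1(G)$ and $c\in K_2\setminus\Phi_2(G)$. For a group $G$ write $\Omega^i(G)=\{g\in G\mid g^{2^i}=e\}$, and let $G^m$ be the subgroup generated by all $m$-th powers of elements of $G$. An $\mathcal N_2$-extension of $G$ is a group in $\mathcal N_2$ containing $G$ as a subgroup. **Theorem.** Let $n>0$ and let $G\in\mathcal N_2\cap\mathcal B_{2^{n+1}}$.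 Then the following are equivalent: (i) Every amalgam $(K_1,K_2;G)$ of $\mathcal N_2\cap\mathcal B_{2^{n+1}}$-groups is weakly embeddable in $\mathcal N_2$. (ii) Every amalgam $(K_1,K_2;G)$ of $\mathcal N_2\cap\mathcal B_{2^{n+1}}$-groups is strongly embeddable in $\mathcal N_2$. (iii) $\Omega^n(Z(G))=G^{2^n}G'$, and for each $x\in G$ and each integer $i$ with $1\le i\le n-1$, at least one of the following holds: (a) $x\in G^{2^i}G'$; or (b) $x^{2^{n-i}}\notin Z(G)$; or (c) $x^{2^n}\neq e$; or (d) no $\mathcal N_2$-extension of $G$ contains a $2^i$-th root of $x$. -/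

import Mathlib

namespace NilTwo

universe u

/-- Membership in the variety of nilpotent groups of class at most two: `[G, G] ⊆ Z(G)`. -/
def IsNilTwo (G : Type u) [Group G] : Prop :=
  commutator G ≤ Subgroup.center G

/-- Membership in the variety of groups of exponent `m`: the identity `g ^ m = 1` holds
(the exact exponent may be a proper divisor of `m`). -/
def IsBurnside (m : ℕ) (G : Type u) [Group G] : Prop :=
  ∀ g : G, g ^ m = 1

/-- `G ^ m G'`, where `G ^ m` is the subgroup generated by the `m`-th powers and `G'` is the
commutator subgroup. -/
def powComm (G : Type u) [Group G] (m : ℕ) : Subgroup G :=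
  Subgroup.closure (Set.range fun g : G => g ^ m) ⊔ commutator G

/-- `Ω^i(G) = {g ∈ G | g ^ (2 ^ i) = 1}`. -/
def Omega (i : ℕ) (G : Type u) [Group G] : Set G :=
  {g | g ^ (2 ^ i) = 1}

/-- Some group of class at most two that contains (a copy of) `G` has an `m`-th root for `x`. -/
def HasRootInExtension {G : Type u} [Group G] (m : ℕ) (x : G) : Prop :=
  ∃ (K : Type u) (_ : Group K) (φ : G →* K),
    IsNilTwo K ∧ Function.Injective φ ∧ ∃ r : K, r ^ m = φ x

section Amalgam

variable {B A C : Type u} [Group B] [Group A] [Group C]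

/-- The amalgam `(A, C; B)` given by `ΦA : B → A`, `ΦC : B → C` is weakly embeddable in the variety
of nilpotent groups of class at most two. -/
def WeaklyEmbeddable (ΦA : B →* A) (ΦC : B →* C) : Prop :=
  ∃ (M : Type u) (_ : Group M) (lA : A →* M) (lC : C →* M),
    IsNilTwo M ∧ Function.Injective lA ∧ Function.Injective lC ∧ lA.comp ΦA = lC.comp ΦC

/-- The amalgam `(A, C; B)` is strongly embeddable: it is embeddable in such a way that moreover
no element of `A \ B` is identified with an element of `C \ B`. -/
def StronglyEmbeddable (ΦA : B →* A) (ΦC : B →* C) : Prop :=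
  ∃ (M : Type u) (_ : Group M) (lA : A →* M) (lC : C →* M),
    IsNilTwo M ∧ Function.Injective lA ∧ Function.Injective lC ∧ lA.comp ΦA = lC.comp ΦC ∧
      ∀ a : A, a ∉ Set.range ΦA → ∀ c : C, c ∉ Set.range ΦC → lA a ≠ lC c

end Amalgam

/-- Every amalgam with core `G` of groups of class at most two and exponent `m` is weakly
embeddable in the variety of nilpotent groups of class at most two. -/
def AllAmalgamsWeak (m : ℕ) (G : Type u) [Group G] : Prop :=
  ∀ (K₁ K₂ : Type u) [Group K₁] [Group K₂] (Φ₁ : G →* K₁) (Φ₂ : G →* K₂),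
    IsNilTwo K₁ → IsBurnside m K₁ → IsNilTwo K₂ → IsBurnside m K₂ →
    Function.Injective Φ₁ → Function.Injective Φ₂ → WeaklyEmbeddable Φ₁ Φ₂

/-- Every amalgam with core `G` of groups of class at most two and exponent `m` is strongly
embeddable in the variety of nilpotent groups of class at most two. -/
def AllAmalgamsStrong (m : ℕ) (G : Type u) [Group G] : Prop :=
  ∀ (K₁ K₂ : Type u) [Group K₁] [Group K₂] (Φ₁ : G →* K₁) (Φ₂ : G →* K₂),
    IsNilTwo K₁ → IsBurnside m K₁ → IsNilTwo K₂ → IsBurnside m K₂ →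
    Function.Injective Φ₁ → Function.Injective Φ₂ → StronglyEmbeddable Φ₁ Φ₂

end NilTwo

namespace NilTwo

open scoped commutatorElement

universe u v w

/-! ### Commutator calculus in class two -/

section Commutators

variable {G : Type u} [Group G]

/-! All three conditions amount to one closure property of `G`: for `i ≤ n`, an element of `G` that
lies in `A ^ (2 ^ i) A'` for some extension `A` of class two and exponent `2 ^ (n + 1)` already lies
in `G ^ (2 ^ i) G'`.

Weak embeddability forces it (`AllAmalgamsWeak.mem_powComm`). If `x` is not in `G ^ (2 ^ i) G'`,
some extension has an element `t` with `t ^ 2 ^ i = 1` and `⁅x, t⁆ ≠ 1`. If also `x = a ^ 2 ^ i * c`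
in `A` with `c` a product of commutators, then a common overgroup would give `⁅x, t⁆ = ⁅a, t ^ 2 ^
i⁆ = 1`. Condition (iii) follows by building suitable `A`: a central element of order dividing `2 ^
n` can be made a commutator, and a root in an arbitrary extension can be replaced, modulo
commutators, by one in an extension of exponent `2 ^ (n + 1)` (`exists_burnside_extension_root`).
Conversely (iii) yields the closure property (`RootCondition.mem_powComm`).

For strong embeddability one must choose the commutators of `a ∈ A` with `c ∈ C`: a bilinear pairing
of the abelianizations, prescribed on `A × G` and `G × C`. With values in an injective group it
exists if `⁅a, d⁆ = ⁅b, c⁆` whenever `a ^ q ≡ b` and `c ^ q ≡ d` modulo commutators, with `b, d ∈ G`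
(`exists_bilinear_extension`). By closure, either `b ≡ b₀ ^ q` and `d ≡ d₀ ^ q` inside `G`, and both
sides are `⁅b₀, d₀⁆ ^ q`, or both sides are trivial. A quotient of the product twisted by this
pairing is the required overgroup (`stronglyEmbeddable_of_pairing`). -/

theorem IsNilTwo.commutatorElement_mem_center (h : IsNilTwo G) (a b : G) :
    ⁅a, b⁆ ∈ Subgroup.center G :=
  h (Subgroup.commutator_mem_commutator (Subgroup.mem_top a) (Subgroup.mem_top b))

theorem isNilTwo_of_commutatorElement_mem_center
    (h : ∀ a b : G, ⁅a, b⁆ ∈ Subgroup.center G) : IsNilTwo G :=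
  Subgroup.commutator_le.2 fun a _ b _ => h a b

theorem IsNilTwo.commutator_mul_left (h : IsNilTwo G) (a b c : G) :
    ⁅a * b, c⁆ = ⁅a, c⁆ * ⁅b, c⁆ := by
  have hc := Subgroup.mem_center_iff.1 (h.commutatorElement_mem_center b c)
  calc ⁅a * b, c⁆ = a * ⁅b, c⁆ * (c * a⁻¹ * c⁻¹) := by simp only [commutatorElement_def]; group
    _ = ⁅a, c⁆ * ⁅b, c⁆ := by
        rw [mul_assoc, ← hc (c * a⁻¹ * c⁻¹)]; simp only [commutatorElement_def]; group

theorem IsNilTwo.commutator_mul_right (h : IsNilTwo G) (a b c : G) :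
    ⁅a, b * c⁆ = ⁅a, b⁆ * ⁅a, c⁆ := by
  rw [← commutatorElement_inv (b * c) a, h.commutator_mul_left, mul_inv_rev,
    commutatorElement_inv, commutatorElement_inv]
  exact (Subgroup.mem_center_iff.1 (h.commutatorElement_mem_center a b) _)

theorem IsNilTwo.commutator_zpow_right (h : IsNilTwo G) (a b : G) (k : ℤ) :
    ⁅a, b ^ k⁆ = ⁅a, b⁆ ^ k :=
  map_zpow (MonoidHom.mk' (fun b => ⁅a, b⁆) (h.commutator_mul_right a)) b k

theorem IsNilTwo.commutator_zpow_left (h : IsNilTwo G) (a b : G) (k : ℤ) :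
    ⁅a ^ k, b⁆ = ⁅a, b⁆ ^ k :=
  map_zpow (MonoidHom.mk' (fun a => ⁅a, b⁆) fun a a' => h.commutator_mul_left a a' b) a k

theorem IsNilTwo.commutator_pow_left (h : IsNilTwo G) (a b : G) (k : ℕ) :
    ⁅a ^ k, b⁆ = ⁅a, b⁆ ^ k := by
  simpa using h.commutator_zpow_left a b k

theorem IsNilTwo.commutator_pow_right (h : IsNilTwo G) (a b : G) (k : ℕ) :
    ⁅a, b ^ k⁆ = ⁅a, b⁆ ^ k := by
  simpa using h.commutator_zpow_right a b k

theorem commutatorElement_eq_one_of_mem_center_left {a : G} (ha : a ∈ Subgroup.center G) (b : G) :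
    ⁅a, b⁆ = 1 :=
  commutatorElement_eq_one_iff_mul_comm.2 (Subgroup.mem_center_iff.1 ha b).symm

theorem commutatorElement_eq_one_of_mem_center_right {b : G} (hb : b ∈ Subgroup.center G) (a : G) :
    ⁅a, b⁆ = 1 :=
  commutatorElement_eq_one_iff_mul_comm.2 (Subgroup.mem_center_iff.1 hb a)

theorem mem_center_iff_commutatorElement_eq_one {a : G} :
    a ∈ Subgroup.center G ↔ ∀ b : G, ⁅a, b⁆ = 1 :=
  ⟨fun ha b => commutatorElement_eq_one_of_mem_center_left ha b, fun h =>
    Subgroup.mem_center_iff.2 fun b => (commutatorElement_eq_one_iff_mul_comm.1 (h b)).symm⟩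

theorem IsNilTwo.mul_pow (h : IsNilTwo G) (a b : G) (k : ℕ) :
    (a * b) ^ k = a ^ k * b ^ k * ⁅b, a⁆ ^ k.choose 2 := by
  induction k with
  | zero => simp
  | succ k ih =>
    have hc := Subgroup.mem_center_iff.1
      ((Subgroup.center G).pow_mem (h.commutatorElement_mem_center b a) (k.choose 2))
    have hc' := Subgroup.mem_center_iff.1
      ((Subgroup.center G).pow_mem (h.commutatorElement_mem_center b a) k)
    have hk : b ^ k * a = a * b ^ k * ⁅b, a⁆ ^ k := by
      rw [← h.commutator_pow_left, Subgroup.mem_center_iff.1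
        (h.commutatorElement_mem_center (b ^ k) a) (a * b ^ k)]
      simp only [commutatorElement_def]; group
    rw [pow_succ (a * b), ih, Nat.choose_succ_succ' k 1, Nat.choose_one_right, pow_add ⁅b, a⁆]
    calc a ^ k * b ^ k * ⁅b, a⁆ ^ k.choose 2 * (a * b)
        = a ^ k * (b ^ k * a) * b * ⁅b, a⁆ ^ k.choose 2 := by
          rw [mul_assoc _ _ (a * b), ← hc]; simp only [mul_assoc]
      _ = a ^ k * a * b ^ k * (⁅b, a⁆ ^ k * b) * ⁅b, a⁆ ^ k.choose 2 := by
          rw [hk]; simp only [mul_assoc]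
      _ = _ := by rw [← hc' b, pow_succ, pow_succ]; simp only [mul_assoc]

theorem choose_two_pow (n : ℕ) : (2 ^ (n + 1)).choose 2 = 2 ^ n * (2 ^ (n + 1) - 1) := by
  rw [Nat.choose_two_right, pow_succ, mul_comm (2 ^ n) 2, mul_assoc, Nat.mul_div_cancel_left _ two_pos]

/-- In a group of class two and exponent `2 ^ (n + 1)`, commutators have exponent `2 ^ n`. -/
theorem IsNilTwo.commutatorElement_pow (h : IsNilTwo G) {n : ℕ} (hb : IsBurnside (2 ^ (n + 1)) G)
    (a b : G) : ⁅a, b⁆ ^ 2 ^ n = 1 := by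
  -- Put `u = ⁅a, b⁆ ^ 2 ^ n`. The power formula gives `u ^ (2 ^ (n + 1) - 1) = 1` and the exponent
  -- gives `u ^ 2 ^ (n + 1) = 1`; these exponents are consecutive.
  have h1 := h.mul_pow b a (2 ^ (n + 1))
  rw [hb, hb, hb, one_mul, one_mul, choose_two_pow, pow_mul] at h1
  have h2 : (⁅a, b⁆ ^ 2 ^ n) ^ 2 ^ (n + 1) = 1 := hb _
  have h3 : 2 ^ (n + 1) = (2 ^ (n + 1) - 1) + 1 := (Nat.sub_add_cancel Nat.one_le_two_pow).symm
  rw [h3, pow_succ, ← h1, one_mul] at h2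
  exact h2

theorem IsNilTwo.pow_mem_center (h : IsNilTwo G) {n : ℕ} (hb : IsBurnside (2 ^ (n + 1)) G)
    (a : G) : a ^ 2 ^ n ∈ Subgroup.center G :=
  mem_center_iff_commutatorElement_eq_one.2 fun b => by
    rw [h.commutator_pow_left, h.commutatorElement_pow hb]

theorem IsNilTwo.mul_pow_of_mem_commutator (h : IsNilTwo G) {b : G} (hb : b ∈ commutator G)
    (a : G) (k : ℕ) : (a * b) ^ k = a ^ k * b ^ k :=
  Commute.mul_pow (Subgroup.mem_center_iff.1 (h hb) a) k

theorem IsNilTwo.commutator_pow_eq_one (h : IsNilTwo G) {n : ℕ} (hb : IsBurnside (2 ^ (n + 1)) G)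
    {c : G} (hc : c ∈ commutator G) : c ^ 2 ^ n = 1 := by
  rw [commutator_eq_closure] at hc
  induction hc using Subgroup.closure_induction with
  | mem x hx => obtain ⟨a, b, rfl⟩ := hx; exact h.commutatorElement_pow hb a b
  | one => simp
  | mul x y hx hy ihx ihy =>
    rw [← commutator_eq_closure] at hx hy
    rw [h.mul_pow_of_mem_commutator hy, ihx, ihy, one_mul]
  | inv x hx ih => rw [inv_pow, ih, inv_one]

/-- In class two, each element of `G ^ m G'` is an `m`-th power times an element of `G'`. -/
theorem IsNilTwo.mem_powComm_iff (h : IsNilTwo G) {m : ℕ} {x : G} :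
    x ∈ powComm G m ↔ ∃ a, ∃ c ∈ commutator G, x = a ^ m * c := by
  constructor
  · intro hx
    rw [powComm, Subgroup.mem_sup_of_normal_right] at hx
    obtain ⟨y, hy, c, hc, rfl⟩ := hx
    suffices ∃ a, ∃ c ∈ commutator G, y = a ^ m * c by
      obtain ⟨a, d, hd, rfl⟩ := this
      exact ⟨a, d * c, mul_mem hd hc, mul_assoc _ _ _⟩
    clear hc
    induction hy using Subgroup.closure_induction with
    | mem y hy => obtain ⟨a, rfl⟩ := hy; exact ⟨a, 1, one_mem _, (mul_one _).symm⟩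
    | one => exact ⟨1, 1, one_mem _, by simp⟩
    | mul y z _ _ hy hz =>
      obtain ⟨a, c, hc, rfl⟩ := hy
      obtain ⟨b, d, hd, rfl⟩ := hz
      have hab : ⁅b, a⁆ ^ m.choose 2 ∈ commutator G :=
        pow_mem (Subgroup.commutator_mem_commutator (Subgroup.mem_top _) (Subgroup.mem_top _)) _
      refine ⟨a * b, (⁅b, a⁆ ^ m.choose 2)⁻¹ * (c * d), mul_mem (inv_mem hab) (mul_mem hc hd), ?_⟩
      rw [h.mul_pow, mul_assoc _ _ (_ * (c * d)), mul_inv_cancel_left, mul_assoc _ c,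
        ← mul_assoc c, ← Subgroup.mem_center_iff.1 (h hc)]
      simp only [mul_assoc]
    | inv y _ hy =>
      obtain ⟨a, c, hc, rfl⟩ := hy
      refine ⟨a⁻¹, c⁻¹, inv_mem hc, ?_⟩
      rw [mul_inv_rev, inv_pow, Subgroup.mem_center_iff.1 (h (inv_mem hc))]
  · rintro ⟨a, c, hc, rfl⟩
    exact mul_mem (Subgroup.mem_sup_left (Subgroup.subset_closure ⟨a, rfl⟩))
      (Subgroup.mem_sup_right hc)

/-- One inclusion in the first half of (iii) is automatic: `2 ^ n`-th powers are central because
commutators have exponent `2 ^ n`, and they are killed by `2 ^ n` because `2 * n ≥ n + 1`. -/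
theorem IsNilTwo.powComm_subset (h : IsNilTwo G) {n : ℕ} (hn : 0 < n)
    (hb : IsBurnside (2 ^ (n + 1)) G) {x : G} (hx : x ∈ powComm G (2 ^ n)) :
    x ∈ Subgroup.center G ∧ x ^ 2 ^ n = 1 := by
  obtain ⟨a, c, hc, rfl⟩ := h.mem_powComm_iff.1 hx
  refine ⟨mul_mem (h.pow_mem_center hb a) (h hc), ?_⟩
  rw [h.mul_pow_of_mem_commutator hc, h.commutator_pow_eq_one hb hc, mul_one, ← pow_mul, ← pow_add]
  obtain ⟨m, rfl⟩ : ∃ m, n = m + 1 := ⟨n - 1, by omega⟩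
  rw [show m + 1 + (m + 1) = (m + 1 + 1) + m by omega, pow_add 2 (m + 1 + 1) m, pow_mul, hb, one_pow]

/-- A subgroup generated by elements of exponent `2 ^ (n + 1)` whose commutators have exponent
`2 ^ n` has exponent `2 ^ (n + 1)`. -/
theorem IsNilTwo.isBurnside_closure (h : IsNilTwo G) {n : ℕ} {S : Set G}
    (h1 : ∀ s ∈ S, s ^ 2 ^ (n + 1) = 1) (h2 : ∀ s ∈ S, ∀ t ∈ S, ⁅s, t⁆ ^ 2 ^ n = 1) :
    IsBurnside (2 ^ (n + 1)) (Subgroup.closure S) := by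
  have h3 : ∀ s ∈ S, ∀ t ∈ Subgroup.closure S, ⁅s, t⁆ ^ 2 ^ n = 1 := by
    intro s hs t ht
    simp only [← h.commutator_pow_left] at h2 ⊢
    induction ht using Subgroup.closure_induction with
    | mem t ht => exact h2 s hs t ht
    | one => simp
    | mul y z _ _ hy hz => rw [h.commutator_mul_right, hy, hz, one_mul]
    | inv y _ hy =>
      rw [← zpow_neg_one, h.commutator_zpow_right, hy, one_zpow]
  -- The correction term in the power of a product has exponent `(2 ^ (n + 1)).choose 2`, a multiple
  -- of `2 ^ n`, so `h3` removes it.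
  have h4 : ∀ s ∈ Subgroup.closure S, s ^ 2 ^ (n + 1) = 1 := by
    intro s hs
    induction hs using Subgroup.closure_induction_left with
    | one => simp
    | mul_left x hx y hy ih =>
      rw [h.mul_pow, h1 x hx, ih, choose_two_pow, pow_mul, ← commutatorElement_inv x y, inv_pow,
        h3 x hx y hy]
      simp
    | inv_mul_cancel x hx y hy ih =>
      rw [h.mul_pow, inv_pow, h1 x hx, ih, choose_two_pow, pow_mul, ← commutatorElement_inv x⁻¹ y,
        inv_pow, ← zpow_neg_one x, h.commutator_zpow_left, zpow_neg_one, inv_pow, inv_pow, h3 x hx y hy]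
      simp
  exact fun g => Subtype.ext (h4 g g.2)

theorem IsNilTwo.subgroup (h : IsNilTwo G) (H : Subgroup G) : IsNilTwo H :=
  isNilTwo_of_commutatorElement_mem_center fun a b => Subgroup.mem_center_iff.2 fun c =>
    Subtype.ext (Subgroup.mem_center_iff.1 (h.commutatorElement_mem_center (a : G) b) c)

theorem map_mem_commutator {H : Type v} [Group H] (φ : G →* H) {x : G} (hx : x ∈ commutator G) :
    φ x ∈ commutator H := by
  have h := Subgroup.mem_map_of_mem φ hx
  rw [commutator_def, Subgroup.map_commutator] at h
  exact Subgroup.commutator_mono le_top le_top h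

end Commutators

/-! ### Central products -/

section CentralProduct

variable {G : Type u} {H : Type v} [Group G] [Group H]

/-- As the two images commute, a commutator in `Q` splits into a commutator from each factor, and
each is central in its own factor. -/
theorem isNilTwo_of_commuting_generators {Q : Type w} [Group Q] {α : G →* Q} {β : H →* Q}
    (hG : IsNilTwo G) (hH : IsNilTwo H) (hc : ∀ g h, Commute (α g) (β h))
    (hs : ∀ x, ∃ g h, x = α g * β h) : IsNilTwo Q := by
  refine isNilTwo_of_commutatorElement_mem_center fun x y => Subgroup.mem_center_iff.2 fun t => ?_
  obtain ⟨g, h, rfl⟩ := hs x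
  obtain ⟨g', h', rfl⟩ := hs y
  obtain ⟨g'', h'', rfl⟩ := hs t
  have e : ⁅α g * β h, α g' * β h'⁆ = α ⁅g, g'⁆ * β ⁅h, h'⁆ := by
    simp only [map_commutatorElement]
    simp only [commutatorElement_def, mul_inv_rev]
    have e1 := (hc g' h).eq
    have e2 := (hc g⁻¹ h').eq
    have e3 := (hc g'⁻¹ (h * h' * h⁻¹)).eq
    have e4 := (hc g⁻¹ h⁻¹).eq
    have e5 := (hc g'⁻¹ h'⁻¹).eq
    have e6 := (hc g⁻¹ (h * h')).eq
    simp only [map_mul, map_inv] at *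
    calc α g * β h * (α g' * β h') * ((β h)⁻¹ * (α g)⁻¹) * ((β h')⁻¹ * (α g')⁻¹)
        = α g * (β h * α g') * β h' * ((β h)⁻¹ * (α g)⁻¹) * ((β h')⁻¹ * (α g')⁻¹) := by
          simp only [mul_assoc]
      _ = α g * α g' * (β h * β h' * (α g)⁻¹) * ((β h)⁻¹) * ((α g')⁻¹ * (β h')⁻¹) := by
          rw [← e1, ← e4, ← e5]; simp only [mul_assoc]
      _ = α g * α g' * (α g)⁻¹ * (β h * β h' * (β h)⁻¹ * (α g')⁻¹) * (β h')⁻¹ := by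
          rw [← e6]; simp only [mul_assoc]
      _ = _ := by rw [← e3]; simp only [mul_assoc]
  rw [e]
  have k1 : α g'' * α ⁅g, g'⁆ = α ⁅g, g'⁆ * α g'' := by
    rw [← map_mul, ← map_mul, Subgroup.mem_center_iff.1 (hG.commutatorElement_mem_center g g')]
  have k2 : β h'' * β ⁅h, h'⁆ = β ⁅h, h'⁆ * β h'' := by
    rw [← map_mul, ← map_mul, Subgroup.mem_center_iff.1 (hH.commutatorElement_mem_center h h')]
  rw [mul_assoc, ← mul_assoc (β h''), ← (hc ⁅g, g'⁆ h'').eq, mul_assoc, k2, ← mul_assoc, k1,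
    mul_assoc, ← mul_assoc (α g''), (hc g'' ⁅h, h'⁆).eq]
  simp only [mul_assoc]

theorem isBurnside_of_commuting_generators {Q : Type w} [Group Q] {α : G →* Q} {β : H →* Q} {m : ℕ}
    (hG : IsBurnside m G) (hH : IsBurnside m H) (hc : ∀ g h, Commute (α g) (β h))
    (hs : ∀ x, ∃ g h, x = α g * β h) : IsBurnside m Q := by
  intro x
  obtain ⟨g, h, rfl⟩ := hs x
  rw [(hc g h).mul_pow, ← map_pow, ← map_pow, hG, hH, map_one, map_one, one_mul]

/-- The central product of two groups, in which a central element `z` of the first is identified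
with a central element `w` of the second. -/
theorem exists_centralProduct {z : G} {w : H} (hz : z ∈ Subgroup.center G)
    (hw : w ∈ Subgroup.center H) (hzw : ∀ k : ℤ, w ^ k = 1 → z ^ k = 1) :
    ∃ (Q : Type max u v) (_ : Group Q) (α : G →* Q) (β : H →* Q), Function.Injective α ∧
      (∀ g h, Commute (α g) (β h)) ∧ (∀ x, ∃ g h, x = α g * β h) ∧ α z = β w := by
  let N : Subgroup (G × H) := Subgroup.zpowers (z, w⁻¹)
  have hN : (z, w⁻¹) ∈ Subgroup.center (G × H) := Subgroup.mem_center_iff.2 fun x =>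
    Prod.ext (Subgroup.mem_center_iff.1 hz _) (Subgroup.mem_center_iff.1 (inv_mem hw) _)
  have hN' : N.Normal := ⟨fun x hx y => by
    have : x ∈ Subgroup.center (G × H) := Subgroup.zpowers_le.2 hN hx
    rwa [Subgroup.mem_center_iff.1 this y, mul_inv_cancel_right]⟩
  refine ⟨(G × H) ⧸ N, inferInstance, (QuotientGroup.mk' N).comp (MonoidHom.inl G H),
    (QuotientGroup.mk' N).comp (MonoidHom.inr G H), ?_, ?_, ?_, ?_⟩
  -- Only `G` has to embed: an element of it that dies is some `z ^ k` with `w ^ k = 1`.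
  · refine (injective_iff_map_eq_one _).2 fun g hg => ?_
    obtain ⟨k, hk⟩ := (QuotientGroup.eq_one_iff _).1 hg
    have hk' : z ^ k = g ∧ w⁻¹ ^ k = 1 := by simpa [Prod.ext_iff] using hk
    rw [← hk'.1]
    exact hzw k (by simpa using hk'.2)
  · intro g h
    refine Commute.map (f := QuotientGroup.mk' N) (x := (g, (1 : H))) (y := ((1 : G), h)) ?_
    exact Prod.ext (by simp) (by simp)
  · intro x
    obtain ⟨⟨g, h⟩, rfl⟩ := QuotientGroup.mk'_surjective N x
    refine ⟨g, h, ?_⟩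
    simp only [MonoidHom.comp_apply]
    rw [← map_mul]
    simp
  · refine QuotientGroup.eq.2 ?_
    rw [← inv_mem_iff]
    convert Subgroup.mem_zpowers (z, w⁻¹) using 1
    simp

end CentralProduct

/-! ### Extending bilinear maps into injective abelian groups -/

section Bilinear

open TensorProduct

theorem exists_comp_eq_of_ker_le {R E X V : Type*} [Ring R] [AddCommGroup E] [AddCommGroup X]
    [AddCommGroup V] [Module R E] [Module R X] [Module R V] (hV : Module.Baer R V) (p : E →ₗ[R] X)
    (φ : E →ₗ[R] V) (h : LinearMap.ker p ≤ LinearMap.ker φ) : ∃ ψ : X →ₗ[R] V, ψ ∘ₗ p = φ := by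
  obtain ⟨ψ, hψ⟩ := hV.extension_property ((LinearMap.ker p).liftQ p le_rfl)
    (LinearMap.ker_eq_bot.1 (Submodule.ker_liftQ_eq_bot _ _ _ le_rfl))
    ((LinearMap.ker p).liftQ φ h)
  refine ⟨ψ, LinearMap.ext fun e => ?_⟩
  simpa using LinearMap.congr_fun hψ (Submodule.Quotient.mk e)

variable {B D X Y V : Type*} [AddCommGroup B] [AddCommGroup D] [AddCommGroup X] [AddCommGroup Y]
  [AddCommGroup V]

/-- The case of `exists_bilinear_extension` in which the first group is finitely generated. -/
theorem exists_bilinear_extension_of_finite [Module.Finite ℤ X] (hV : Module.Baer ℤ V)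
    (i : B →ₗ[ℤ] X) (j : D →ₗ[ℤ] Y) (f : X →ₗ[ℤ] D →ₗ[ℤ] V) (g : B →ₗ[ℤ] Y →ₗ[ℤ] V)
    (h : ∀ (q : ℤ) (x : X) (y : Y) (b : B) (d : D), q • x = i b → q • y = j d → f x d = g b y) :
    ∃ β : X →ₗ[ℤ] Y →ₗ[ℤ] V, (∀ x d, β x (j d) = f x d) ∧ ∀ b y, β (i b) y = g b y := by
  obtain ⟨m, π, hπ⟩ := Module.Finite.exists_fin' ℤ X
  -- Smith normal form adapts a basis of `ℤ ^ m` to the preimage of `i B`, so the extension can be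
  -- built one basis vector at a time.
  obtain ⟨r, s⟩ := (Submodule.comap π (LinearMap.range i)).smithNormalForm (Pi.basisFun ℤ (Fin m))
  have hgen : ∀ k, ∃ d : ℤ, ∃ b : B, i b = d • π (s.bM k) ∧
      ∀ l, s.f l = k → d = s.a l := by
    intro k
    by_cases hk : ∃ l, s.f l = k
    · obtain ⟨l, rfl⟩ := hk
      obtain ⟨b, hb⟩ := (s.bN l).2
      refine ⟨s.a l, b, ?_, fun l' hl' => by rw [s.f.injective hl']⟩
      rw [hb, s.snf, map_smul]
    -- A basis vector that contributes nothing to the preimage gets multiplier `0`, so that the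
    -- second condition on `ψ` below is vacuous.
    · exact ⟨0, 0, by simp, fun l hl => (hk ⟨l, hl⟩).elim⟩
  choose d b hb hd using hgen
  -- The two demands on `ψ` prescribe it along `j` and along multiplication by `d k`; hypothesis `h`
  -- with `q = d k` says exactly that they are compatible.
  have hext : ∀ k, ∃ ψ : Y →ₗ[ℤ] V, (∀ e, ψ (j e) = f (π (s.bM k)) e) ∧
      ∀ y, d k • ψ y = g (b k) y := by
    intro k
    obtain ⟨ψ, hψ⟩ := exists_comp_eq_of_ker_le hV (LinearMap.coprod j (d k • LinearMap.id))
      (LinearMap.coprod (f (π (s.bM k))) (g (b k))) (by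
        rintro ⟨e, y⟩ he
        have he' : j e + d k • y = 0 := by simpa using he
        have := h (d k) (π (s.bM k)) (-y) (b k) e (hb k).symm
          (by rw [smul_neg]; exact (eq_neg_of_add_eq_zero_left he').symm)
        simp [this])
    refine ⟨ψ, fun e => ?_, fun y => ?_⟩
    · simpa using LinearMap.congr_fun hψ (e, 0)
    · simpa using LinearMap.congr_fun hψ (0, y)
  choose ψ hψ1 hψ2 using hext
  let γ : (Fin m → ℤ) →ₗ[ℤ] Y →ₗ[ℤ] V := s.bM.constr ℤ ψ
  have hγ : ∀ k, γ (s.bM k) = ψ k := fun k => s.bM.constr_basis ℤ ψ k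
  have hγ1 : ∀ e x, γ x (j e) = f (π x) e := by
    intro e x
    have : γ.flip (j e) = (f.comp π).flip e := s.bM.ext fun k => by simp [hγ, hψ1]
    exact LinearMap.congr_fun this x
  have hγ2 : ∀ x ∈ Submodule.comap π (LinearMap.range i), ∃ c, i c = π x ∧ γ x = g c := by
    intro x hx
    obtain ⟨c, hc⟩ := s.bN.mem_submodule_iff.1 hx
    subst hc
    refine ⟨c.sum fun l z => z • b (s.f l), ?_, ?_⟩
    · simp only [Finsupp.sum, map_sum, map_smul]
      refine Finset.sum_congr rfl fun l _ => ?_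
      rw [hb, s.snf, map_smul, hd _ l rfl]
    · simp only [Finsupp.sum, map_sum, map_smul]
      refine Finset.sum_congr rfl fun l _ => ?_
      rw [s.snf, map_smul, hγ]
      congr 1
      ext y
      rw [← hψ2, hd _ l rfl]
      rfl
  -- Here `h` is used with `q = 0`: it makes `g` vanish on the kernel of `i`, so the choice of `c`
  -- is immaterial.
  have hγ3 : ∀ x c, i c = π x → γ x = g c := by
    intro x c hc
    obtain ⟨c', hc', hx⟩ := hγ2 x ⟨c, hc⟩
    rw [hx]
    ext y
    have := h 0 0 y (c' - c) 0 (by simp [hc, hc']) (by simp)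
    rw [map_zero, map_sub, LinearMap.sub_apply] at this
    exact sub_eq_zero.1 this.symm
  have hker : LinearMap.ker π ≤ LinearMap.ker γ := by
    intro x hx
    rw [LinearMap.mem_ker] at hx ⊢
    rw [hγ3 x 0 (by simp [hx]), map_zero]
  let β : X →ₗ[ℤ] Y →ₗ[ℤ] V := (LinearMap.ker π).liftQ γ hker ∘ₗ
    (π.quotKerEquivOfSurjective hπ).symm.toLinearMap
  have hβ : ∀ x, β (π x) = γ x := by
    intro x
    have : (π.quotKerEquivOfSurjective hπ).symm (π x) = Submodule.Quotient.mk x :=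
      (LinearEquiv.symm_apply_eq _).2 rfl
    simp [β, this]
  refine ⟨β, fun x e => ?_, fun c y => ?_⟩
  · obtain ⟨x, rfl⟩ := hπ x
    rw [hβ, hγ1]
  · obtain ⟨x, hx⟩ := hπ (i c)
    rw [← hx, hβ, hγ3 x c hx.symm]

/-- Simultaneous extension of two bilinear maps `X × D → V` and `B × Y → V` with values in an
injective group to `X × Y`, along homomorphisms `B → X` and `D → Y`. -/
theorem exists_bilinear_extension (hV : Module.Baer ℤ V)
    (i : B →ₗ[ℤ] X) (j : D →ₗ[ℤ] Y) (f : X →ₗ[ℤ] D →ₗ[ℤ] V) (g : B →ₗ[ℤ] Y →ₗ[ℤ] V)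
    (h : ∀ (q : ℤ) (x : X) (y : Y) (b : B) (d : D), q • x = i b → q • y = j d → f x d = g b y) :
    ∃ β : X →ₗ[ℤ] Y →ₗ[ℤ] V, (∀ x d, β x (j d) = f x d) ∧ ∀ b y, β (i b) y = g b y := by
  -- The prescribed values form a linear map on `X ⊗ D × B ⊗ Y`, to be factored through `X ⊗ Y`.
  obtain ⟨ψ, hψ⟩ := exists_comp_eq_of_ker_le hV
    (LinearMap.coprod (LinearMap.lTensor X j) (LinearMap.rTensor Y i))
    (LinearMap.coprod (TensorProduct.lift f) (TensorProduct.lift g)) (by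
      rintro ⟨s, t⟩ hst
      have hst' : LinearMap.lTensor X j s = LinearMap.rTensor Y i (-t) := by
        have : LinearMap.lTensor X j s + LinearMap.rTensor Y i t = 0 := by simpa using hst
        rw [map_neg]; exact eq_neg_of_add_eq_zero_left this
      suffices TensorProduct.lift f s = TensorProduct.lift g (-t) by simp [this]
      generalize -t = t at hst'
      clear hst
      -- An equality of tensors already holds over a finitely generated subgroup `Q` of `X`. The
      -- finite case gives a form on `Q × Y`, and evaluating it on the two equal tensors gives the
      -- claim.
      obtain ⟨P, hP, s, rfl⟩ := TensorProduct.exists_of_fg s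
      obtain ⟨P', hP', t, rfl⟩ := TensorProduct.exists_of_fg t
      let i' : P' →ₗ[ℤ] P'.map i := i.submoduleMap P'
      have e : LinearMap.rTensor Y P.subtype (LinearMap.lTensor P j s) =
          LinearMap.rTensor Y (P'.map i).subtype (LinearMap.rTensor Y i' t) := by
        rw [← LinearMap.comp_apply, LinearMap.rTensor_comp_lTensor, ← LinearMap.lTensor_comp_rTensor,
          LinearMap.comp_apply, hst', ← LinearMap.rTensor_comp_apply,
          ← LinearMap.rTensor_comp_apply]
        rfl
      obtain ⟨Q, hPQ, hP'Q, hQ, e⟩ := TensorProduct.eq_of_fg_of_subtype_eq' hP (hP'.map i) e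
      have : Module.Finite ℤ Q := Module.Finite.iff_fg.2 hQ
      obtain ⟨β, hβ1, hβ2⟩ := exists_bilinear_extension_of_finite hV
        ((Submodule.inclusion hP'Q).comp i') j (f.comp Q.subtype) (g.comp P'.subtype)
        (fun q x y b d hx hy => h q x y b d (congrArg Subtype.val hx) hy)
      have e1 : TensorProduct.lift β ∘ₗ LinearMap.rTensor Y (Submodule.inclusion hPQ) ∘ₗ
          LinearMap.lTensor P j = TensorProduct.lift f ∘ₗ LinearMap.rTensor D P.subtype :=
        TensorProduct.ext' fun x y => by simp [hβ1]
      have e2 : TensorProduct.lift β ∘ₗ LinearMap.rTensor Y (Submodule.inclusion hP'Q) ∘ₗ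
          LinearMap.rTensor Y i' = TensorProduct.lift g ∘ₗ LinearMap.rTensor Y P'.subtype :=
        TensorProduct.ext' fun x y => by
          have := hβ2 x y
          simpa using this
      have e3 := congrArg (TensorProduct.lift β) e
      exact (LinearMap.congr_fun e1 s).symm.trans (e3.trans (LinearMap.congr_fun e2 t)))
  refine ⟨TensorProduct.curry ψ, fun x d => ?_, fun b y => ?_⟩
  · simpa using LinearMap.congr_fun hψ (x ⊗ₜ d, 0)
  · simpa using LinearMap.congr_fun hψ (0, b ⊗ₜ y)

/-- Characters with values in `ℚ / ℤ` separate points, and a power of a divisible group is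
divisible, hence injective. -/
theorem exists_injective_hom_baer (V : Type u) [AddCommGroup V] :
    ∃ (W : Type u) (_ : AddCommGroup W) (ι : V →+ W), Function.Injective ι ∧ Module.Baer ℤ W := by
  refine ⟨CharacterModule V → AddCircle (1 : ℚ), inferInstance,
    { toFun := fun v c => c v, map_zero' := ?_, map_add' := ?_ }, ?_, ?_⟩
  · ext c; simp
  · intro x y; ext c; simp
  · refine (injective_iff_map_eq_zero _).2 fun v hv => ?_
    exact CharacterModule.eq_zero_of_character_apply fun c => congrFun hv c
  · exact Module.Baer.of_divisible _

end Bilinear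

/-! ### Products twisted by a pairing -/

section TwistedProduct

variable {A : Type u} {C : Type v} {V : Type w} [Group A] [Group C] [CommGroup V]

/-- The product `A × C × V` with multiplication twisted by a bihomomorphism `β`, so that
`β a c` becomes the commutator of `a` and `c`. -/
@[ext]
structure TwistedProduct (β : A →* C →* V) where
  fst : A
  snd : C
  val : V

namespace TwistedProduct

variable (β : A →* C →* V)

instance : Mul (TwistedProduct β) :=
  ⟨fun x y => ⟨x.fst * y.fst, x.snd * y.snd, x.val * y.val * (β y.fst x.snd)⁻¹⟩⟩

instance : One (TwistedProduct β) := ⟨⟨1, 1, 1⟩⟩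

instance : Inv (TwistedProduct β) :=
  ⟨fun x => ⟨x.fst⁻¹, x.snd⁻¹, x.val⁻¹ * (β x.fst x.snd)⁻¹⟩⟩

variable {β}

theorem mul_def (x y : TwistedProduct β) :
    x * y = ⟨x.fst * y.fst, x.snd * y.snd, x.val * y.val * (β y.fst x.snd)⁻¹⟩ := rfl

theorem one_def : (1 : TwistedProduct β) = ⟨1, 1, 1⟩ := rfl

theorem inv_def (x : TwistedProduct β) :
    x⁻¹ = ⟨x.fst⁻¹, x.snd⁻¹, x.val⁻¹ * (β x.fst x.snd)⁻¹⟩ := rfl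

instance : Group (TwistedProduct β) :=
  Group.ofLeftAxioms
    (fun x y z => by
      ext
      · exact mul_assoc _ _ _
      · exact mul_assoc _ _ _
      · simp only [mul_def, map_mul, MonoidHom.mul_apply, mul_inv_rev]
        simp only [mul_comm, mul_left_comm, mul_assoc])
    (fun x => by ext <;> simp [mul_def, one_def])
    (fun x => by
      ext
      · simp [mul_def, one_def, inv_def]
      · simp [mul_def, one_def, inv_def]
      · simp only [mul_def, one_def, inv_def, map_inv, inv_inv]
        simp [mul_comm])

variable (β)

/-- The first factor of a twisted product. -/
def inl : A →* TwistedProduct β := MonoidHom.mk' (fun a => ⟨a, 1, 1⟩) fun a b => by simp [mul_def]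

/-- The second factor of a twisted product. -/
def inr : C →* TwistedProduct β := MonoidHom.mk' (fun c => ⟨1, c, 1⟩) fun a b => by simp [mul_def]

/-- The projection of a twisted product to the first factor. -/
def fstHom : TwistedProduct β →* A := MonoidHom.mk' fst fun _ _ => rfl

/-- The projection of a twisted product to the second factor. -/
def sndHom : TwistedProduct β →* C := MonoidHom.mk' snd fun _ _ => rfl

theorem inl_injective : Function.Injective (inl β) := fun _ _ h => congrArg fst h

variable {β}

theorem commutator_inl_inr (a : A) (c : C) : ⁅inl β a, inr β c⁆ = ⟨1, 1, β a c⟩ := by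
  rw [commutatorElement_def, mul_assoc, ← mul_inv_rev, mul_inv_eq_iff_eq_mul]
  simp [inl, inr, mul_def]

theorem mem_center {x : TwistedProduct β} (h1 : x.fst ∈ Subgroup.center A)
    (h2 : x.snd ∈ Subgroup.center C) (h3 : ∀ c, β x.fst c = 1) (h4 : ∀ a, β a x.snd = 1) :
    x ∈ Subgroup.center (TwistedProduct β) :=
  Subgroup.mem_center_iff.2 fun y => TwistedProduct.ext (Subgroup.mem_center_iff.1 h1 _)
    (Subgroup.mem_center_iff.1 h2 _) (by simp [mul_def, h3, h4, mul_comm])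

theorem isNilTwo (hA : IsNilTwo A) (hC : IsNilTwo C) : IsNilTwo (TwistedProduct β) :=
  fun _ hx => mem_center (hA (map_mem_commutator (fstHom β) hx))
    (hC (map_mem_commutator (sndHom β) hx))
    (fun c => Abelianization.commutator_subset_ker (β.flip c)
      (map_mem_commutator (fstHom β) hx))
    (fun a => Abelianization.commutator_subset_ker (β a)
      (map_mem_commutator (sndHom β) hx))

theorem pow_def (x : TwistedProduct β) (k : ℕ) :
    x ^ k = ⟨x.fst ^ k, x.snd ^ k, x.val ^ k * ((β x.fst x.snd) ^ k.choose 2)⁻¹⟩ := by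
  induction k with
  | zero => ext <;> simp [one_def]
  | succ k ih =>
    rw [pow_succ, ih, mul_def, Nat.choose_succ_succ' k 1, Nat.choose_one_right]
    ext
    · simp [pow_succ]
    · simp [pow_succ]
    · simp only [map_pow, pow_succ, pow_add, mul_inv_rev]
      simp only [mul_comm, mul_left_comm, mul_assoc]

theorem isBurnside {n i : ℕ} (hi : i ≤ n) (hA : IsBurnside (2 ^ (n + 1)) A)
    (hC : IsBurnside (2 ^ (n + 1)) C) (hV : ∀ v : V, v ^ 2 ^ i = 1) :
    IsBurnside (2 ^ (n + 1)) (TwistedProduct β) := by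
  have hV' : ∀ v : V, v ^ 2 ^ n = 1 := fun v => by
    obtain ⟨k, hk⟩ := pow_dvd_pow 2 hi
    rw [hk, pow_mul, hV, one_pow]
  intro x
  rw [pow_def, hA, hC, choose_two_pow, pow_mul, hV', one_pow, pow_succ 2 n, pow_mul, hV']
  simp [one_def]

end TwistedProduct

theorem isNilTwo_of_commGroup (A : Type u) [CommGroup A] : IsNilTwo A :=
  isNilTwo_of_commutatorElement_mem_center fun a b => by
    rw [commutatorElement_eq_one_iff_mul_comm.2 (mul_comm a b)]; exact one_mem _

theorem isBurnside_multiplicative_zmod {m N : ℕ} (h : N ∣ m) :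
    IsBurnside m (Multiplicative (ZMod N)) := by
  intro x
  obtain ⟨k, rfl⟩ := h
  rw [← toAdd_eq_zero]
  simp

/-- A group of class two and exponent `2 ^ (n + 1)` with a commutator of order `2 ^ n`. -/
theorem exists_commutatorElement_order (n : ℕ) :
    ∃ (H : Type) (_ : Group H), IsNilTwo H ∧ IsBurnside (2 ^ (n + 1)) H ∧
      ∃ s t : H, ∀ k : ℤ, ⁅s, t⁆ ^ k = 1 → (2 ^ n : ℤ) ∣ k := by
  let R := ZMod (2 ^ n)
  -- With the multiplication of `ℤ / 2 ^ n` as pairing, the twisted product is a Heisenberg group.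
  let β : Multiplicative R →* Multiplicative R →* Multiplicative R :=
    MonoidHom.mk' (fun a => (AddMonoidHom.mulLeft a.toAdd).toMultiplicative) fun a b =>
      MonoidHom.ext fun c => congrArg Multiplicative.ofAdd (add_mul a.toAdd b.toAdd c.toAdd)
  have hR : IsBurnside (2 ^ n) (Multiplicative R) := isBurnside_multiplicative_zmod dvd_rfl
  have hR' : IsBurnside (2 ^ (n + 1)) (Multiplicative R) :=
    isBurnside_multiplicative_zmod (pow_dvd_pow 2 n.le_succ)
  refine ⟨TwistedProduct β, inferInstance,
    TwistedProduct.isNilTwo (isNilTwo_of_commGroup _) (isNilTwo_of_commGroup _),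
    TwistedProduct.isBurnside le_rfl hR' hR' hR, TwistedProduct.inl β (Multiplicative.ofAdd 1),
    TwistedProduct.inr β (Multiplicative.ofAdd 1), fun k hk => ?_⟩
  rw [← (TwistedProduct.isNilTwo (isNilTwo_of_commGroup _)
    (isNilTwo_of_commGroup _)).commutator_zpow_left, ← map_zpow,
    TwistedProduct.commutator_inl_inr] at hk
  have h1 : ((k • (1 : R)) * 1 : R) = 0 := congrArg TwistedProduct.val hk
  have h2 : ((k : ℤ) : R) = 0 := by simpa using h1
  have h3 := (ZMod.intCast_zmod_eq_zero_iff_dvd k (2 ^ n)).1 h2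
  exact_mod_cast h3

/-- The element `x` survives in `V = G / G ^ (2 ^ i) G'`, which has exponent `2 ^ i`. Pairing `G`
with `ℤ / 2 ^ i` by powers in `V` makes the class of `x` its commutator with the generator `c`. -/
theorem IsNilTwo.exists_extension_commutator_ne_one {G : Type u} [Group G] (h : IsNilTwo G)
    {n i : ℕ} (hi : i ≤ n) (hb : IsBurnside (2 ^ (n + 1)) G) {x : G} (hx : x ∉ powComm G (2 ^ i)) :
    ∃ (C : Type u) (_ : Group C) (φ : G →* C), IsNilTwo C ∧ IsBurnside (2 ^ (n + 1)) C ∧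
      Function.Injective φ ∧ ∃ c : C, c ^ 2 ^ i = 1 ∧ ⁅φ x, c⁆ ≠ 1 := by
  let P : Subgroup (Abelianization G) := (powMonoidHom (2 ^ i)).range
  let V := Abelianization G ⧸ P
  let χ : G →* V := (QuotientGroup.mk' P).comp Abelianization.of
  have hV : ∀ v : V, v ^ 2 ^ i = 1 := by
    intro v
    obtain ⟨v, rfl⟩ := QuotientGroup.mk'_surjective P v
    rw [← map_pow]
    exact (QuotientGroup.eq_one_iff _).2 ⟨v, rfl⟩
  have hχ : χ x ≠ 1 := by
    intro hx1
    obtain ⟨y, hy⟩ := (QuotientGroup.eq_one_iff _).1 hx1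
    obtain ⟨y, rfl⟩ := QuotientGroup.mk_surjective y
    have hy' : (y ^ 2 ^ i)⁻¹ * x ∈ commutator G := QuotientGroup.eq.1 hy
    exact hx (h.mem_powComm_iff.2 ⟨y, _, hy', (mul_inv_cancel_left _ _).symm⟩)
  have : NeZero (2 ^ i) := ⟨by positivity⟩
  let β : G →* Multiplicative (ZMod (2 ^ i)) →* V :=
    MonoidHom.mk' (fun g => MonoidHom.mk' (fun c => χ g ^ (Multiplicative.toAdd c).val)
      fun c d => by
        rw [toAdd_mul, ZMod.val_add, ← pow_add]
        exact (pow_eq_pow_mod _ (hV _)).symm)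
      fun g g' => MonoidHom.ext fun c =>
        (congrArg (· ^ (Multiplicative.toAdd c).val) (map_mul χ g g')).trans
          (_root_.mul_pow (χ g) (χ g') _)
  have hC : IsBurnside (2 ^ i) (Multiplicative (ZMod (2 ^ i))) :=
    isBurnside_multiplicative_zmod dvd_rfl
  refine ⟨TwistedProduct β, inferInstance, TwistedProduct.inl β,
    TwistedProduct.isNilTwo h (isNilTwo_of_commGroup _),
    TwistedProduct.isBurnside hi hb
      (isBurnside_multiplicative_zmod (pow_dvd_pow 2 (by omega))) hV,
    TwistedProduct.inl_injective β,
    TwistedProduct.inr β (Multiplicative.ofAdd 1), ?_, ?_⟩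
  · rw [← map_pow, hC, map_one]
  · rw [TwistedProduct.commutator_inl_inr]
    intro h1
    have h2 : χ x ^ (1 : ZMod (2 ^ i)).val = 1 := congrArg TwistedProduct.val h1
    rw [ZMod.val_one_eq_one_mod, ← pow_eq_pow_mod _ (hV _), pow_one] at h2
    exact hχ h2

end TwistedProduct

/-! ### Necessity: constructing extensions that test the core -/

section Necessity

variable {G : Type u} [Group G] {n : ℕ}

/-- If `x` becomes an element of `A ^ (2 ^ i) A'` in an extension `A` of `G`, then weak embeddability
of all amalgams with core `G` forces `x ∈ G ^ (2 ^ i) G'`. -/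
theorem AllAmalgamsWeak.mem_powComm (hw : AllAmalgamsWeak (2 ^ (n + 1)) G) (hG : IsNilTwo G)
    (hb : IsBurnside (2 ^ (n + 1)) G) {i : ℕ} (hi : i ≤ n) {x : G} {A : Type u} [Group A]
    {φ : G →* A} (hA : IsNilTwo A) (hbA : IsBurnside (2 ^ (n + 1)) A) (hφ : Function.Injective φ)
    {a c : A} (hc : c ∈ commutator A) (hx : φ x = a ^ 2 ^ i * c) : x ∈ powComm G (2 ^ i) := by
  by_contra hx'
  obtain ⟨C, _, ψ, hC, hbC, hψ, t, ht, hxt⟩ := hG.exists_extension_commutator_ne_one hi hb hx'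
  obtain ⟨M, _, lA, lC, hM, -, hlC, hl⟩ := hw A C φ ψ hA hbA hC hbC hφ hψ
  refine hxt (hlC ?_)
  -- In `M` one has `⁅x, t⁆ = ⁅a, t⁆ ^ 2 ^ i = ⁅a, t ^ 2 ^ i⁆ = 1`.
  have e : lC (ψ x) = lA (φ x) := (DFunLike.congr_fun hl x).symm
  rw [map_commutatorElement, e, hx, map_mul, hM.commutator_mul_left,
    commutatorElement_eq_one_of_mem_center_left (hM (map_mem_commutator lA hc)), mul_one, map_pow,
    hM.commutator_pow_left, ← hM.commutator_pow_right, ← map_pow, ht, map_one,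
    commutatorElement_one_right]

theorem commutatorElement_mem_commutator (a b : G) : ⁅a, b⁆ ∈ commutator G :=
  Subgroup.commutator_mem_commutator (Subgroup.mem_top a) (Subgroup.mem_top b)

theorem zpow_eq_one_of_dvd {x : G} {m : ℕ} (hx : x ^ m = 1) {k : ℤ} (hk : (m : ℤ) ∣ k) :
    x ^ k = 1 := by
  obtain ⟨l, rfl⟩ := hk
  rw [zpow_mul, zpow_natCast, hx, one_zpow]

/-- A central element of order dividing `2 ^ n` becomes a commutator in a suitable extension. -/
theorem IsNilTwo.exists_extension_mem_commutator (hG : IsNilTwo G) {x : G}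
    (hx : x ∈ Subgroup.center G) (hxn : x ^ 2 ^ n = 1) :
    ∃ (A : Type u) (_ : Group A) (φ : G →* A), IsNilTwo A ∧ Function.Injective φ ∧
      (IsBurnside (2 ^ (n + 1)) G → IsBurnside (2 ^ (n + 1)) A) ∧ ∃ s t : A, φ x = ⁅s, t⁆ ∧
        s ^ 2 ^ (n + 1) = 1 ∧ t ^ 2 ^ (n + 1) = 1 ∧
          (∀ g, Commute (φ g) s) ∧ ∀ g, Commute (φ g) t := by
  obtain ⟨H, _, hH, hbH, s, t, hst⟩ := exists_commutatorElement_order n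
  obtain ⟨A, _, α, β, hα, hc, hs, hz⟩ := exists_centralProduct hx
    (hH.commutatorElement_mem_center s t)
    (fun k hk => zpow_eq_one_of_dvd hxn (by exact_mod_cast hst k hk))
  refine ⟨A, inferInstance, α, isNilTwo_of_commuting_generators hG hH hc hs, hα,
    fun hb => isBurnside_of_commuting_generators hb hbH hc hs, β s, β t, ?_, ?_, ?_,
    fun g => hc g s, fun g => hc g t⟩
  · rw [hz, map_commutatorElement]
  · rw [← map_pow, hbH, map_one]
  · rw [← map_pow, hbH, map_one]

/-- If `r` is a `2 ^ i`-th root of `x` whose `2 ^ n`-th power is central, then after adjoining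
central elements and dividing out by a commutator, the root can be chosen to have order dividing
`2 ^ n`. -/
theorem IsNilTwo.exists_extension_root (hK : IsNilTwo G) {i : ℕ} {r : G}
    (hr : r ^ 2 ^ n ∈ Subgroup.center G) (hrn : r ^ 2 ^ (n + i) = 1) :
    ∃ (Q : Type u) (_ : Group Q) (φ : G →* Q), IsNilTwo Q ∧ Function.Injective φ ∧
      ∃ w s t : Q, φ (r ^ 2 ^ i) = (φ r * w) ^ 2 ^ i * ⁅s, t⁆ ∧ (φ r * w) ^ 2 ^ n = 1 ∧
        (∀ g, ⁅φ g, w⁆ = 1) ∧ (∀ g, ⁅φ g, s⁆ = 1) ∧ (∀ g, ⁅φ g, t⁆ = 1) ∧ ⁅w, s⁆ = 1 ∧ ⁅w, t⁆ = 1 ∧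
        s ^ 2 ^ (n + 1) = 1 ∧ t ^ 2 ^ (n + 1) = 1 ∧ ⁅s, t⁆ ^ 2 ^ n = 1 := by
  have hwi : ∀ {H : Type u} [Group H] {w : H}, w ^ 2 ^ (n + i) = 1 → (w ^ 2 ^ i) ^ 2 ^ n = 1 :=
    fun h => by rw [← pow_mul, ← pow_add, add_comm i n, h]
  -- A central `w` with `w ^ 2 ^ n = r ^ 2 ^ n` is adjoined, so `r * w⁻¹` is killed by `2 ^ n`.
  let W := Multiplicative (ZMod (2 ^ (n + i)))
  let w : W := Multiplicative.ofAdd 1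
  have hwn : w ^ 2 ^ (n + i) = 1 := isBurnside_multiplicative_zmod dvd_rfl w
  have hw : ∀ k : ℤ, (w ^ 2 ^ n) ^ k = 1 → (r ^ 2 ^ n) ^ k = 1 := by
    intro k hk
    rw [← zpow_natCast, ← zpow_mul] at hk ⊢
    refine zpow_eq_one_of_dvd hrn ?_
    have h1 : ((2 ^ n : ℕ) * k : ℤ) • (1 : ZMod (2 ^ (n + i))) = 0 := hk
    rw [zsmul_one] at h1
    exact (ZMod.intCast_zmod_eq_zero_iff_dvd _ _).1 h1
  have hW : IsNilTwo W := isNilTwo_of_commGroup W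
  obtain ⟨P, _, α, β, hα, hc, hs, hz⟩ := exists_centralProduct hr
    (w := w ^ 2 ^ n) (Subgroup.mem_center_iff.2 fun g => mul_comm g _) hw
  have hP : IsNilTwo P := isNilTwo_of_commuting_generators hK hW hc hs
  have hwc : ∀ v : W, β v ∈ Subgroup.center P := by
    refine fun v => Subgroup.mem_center_iff.2 fun p => ?_
    obtain ⟨g, v', rfl⟩ := hs p
    rw [mul_assoc, ← map_mul, mul_comm v' v, map_mul, ← mul_assoc, (hc g v).eq, mul_assoc]
  -- The error `w ^ 2 ^ i` between the `2 ^ i`-th powers of `r` and `r * w⁻¹` is central and killed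
  -- by `2 ^ n`, so it can be made a commutator.
  obtain ⟨Q, _, φ, hQ, hφ, -, s, t, hst, hs1, ht1, hsc, htc⟩ :=
    hP.exists_extension_mem_commutator (n := n) (x := β w ^ 2 ^ i)
      (Subgroup.pow_mem _ (hwc w) _)
      (hwi (by rw [← map_pow, hwn, map_one]))
  have hcw : ∀ g, Commute (φ (α g)) (φ (β w)⁻¹) := fun g => Commute.map (hc g w).inv_right φ
  refine ⟨Q, inferInstance, φ.comp α, hQ, hφ.comp hα, φ (β w)⁻¹, s, t, ?_, ?_, ?_, ?_, ?_, ?_, ?_,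
    hs1, ht1, ?_⟩
  · rw [MonoidHom.comp_apply, MonoidHom.comp_apply, (hcw r).mul_pow, ← hst, ← map_pow φ, mul_assoc,
      ← map_pow φ, ← map_mul φ, inv_pow, inv_mul_cancel, map_one, mul_one, map_pow]
  · rw [MonoidHom.comp_apply, (hcw r).mul_pow, ← map_pow φ, ← map_pow φ, ← map_mul, ← map_pow α, hz,
      map_pow, inv_pow, mul_inv_cancel, map_one]
  · exact fun g => commutatorElement_eq_one_iff_commute.2 (hcw g)
  · exact fun g => commutatorElement_eq_one_iff_commute.2 (hsc (α g))
  · exact fun g => commutatorElement_eq_one_iff_commute.2 (htc (α g))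
  · exact commutatorElement_eq_one_iff_commute.2 (hsc _)
  · exact commutatorElement_eq_one_iff_commute.2 (htc _)
  · rw [← hst, ← map_pow, hwi (by rw [← map_pow, hwn, map_one]), map_one]

/-- The power `r ^ 2 ^ n` equals `x ^ 2 ^ (n - i)`, so it commutes with `G` as well as with `r`. -/
theorem pow_mem_center_closure {K : Type v} [Group K] (hK : IsNilTwo K) {φ : G →* K}
    {i : ℕ} (hi : i ≤ n) {x : G} (hx : x ^ 2 ^ (n - i) ∈ Subgroup.center G) {r : K}
    (hr : r ^ 2 ^ i = φ x) {y : K} (hy : y ∈ Subgroup.closure (Set.range φ ∪ {r})) :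
    ⁅r ^ 2 ^ n, y⁆ = 1 := by
  have e : r ^ 2 ^ n = φ (x ^ 2 ^ (n - i)) := by
    rw [map_pow, ← hr, ← pow_mul, ← pow_add, Nat.add_sub_cancel' hi]
  induction hy using Subgroup.closure_induction with
  | mem y hy =>
    rcases hy with ⟨g, rfl⟩ | rfl
    · rw [e, ← map_commutatorElement, commutatorElement_eq_one_of_mem_center_left hx, map_one]
    · exact commutatorElement_eq_one_iff_commute.2 (Commute.pow_self _ _)
  | one => exact commutatorElement_one_right _
  | mul y z _ _ hy hz => rw [hK.commutator_mul_right, hy, hz, one_mul]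
  | inv y _ hy => rw [← zpow_neg_one, hK.commutator_zpow_right, hy, one_zpow]

/-- The given extension may have the wrong exponent. After restricting to the subgroup generated by
`G` and the root, the root is corrected to one of order dividing `2 ^ n`, at the cost of a
commutator `⁅s, t⁆`. All commutators among `G`, the corrected root, `s` and `t` then have exponent
`2 ^ n`, so `isBurnside_closure` applies. -/
theorem IsNilTwo.exists_burnside_extension_root (hG : IsNilTwo G)
    (hb : IsBurnside (2 ^ (n + 1)) G) {i : ℕ} (hi : i ≤ n) {x : G}
    (hx : x ^ 2 ^ (n - i) ∈ Subgroup.center G) (hxn : x ^ 2 ^ n = 1)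
    (hr : HasRootInExtension (2 ^ i) x) :
    ∃ (A : Type u) (_ : Group A) (φ : G →* A), IsNilTwo A ∧ IsBurnside (2 ^ (n + 1)) A ∧
      Function.Injective φ ∧ ∃ a : A, ∃ c ∈ commutator A, φ x = a ^ 2 ^ i * c := by
  obtain ⟨K, _, φ, hK, hφ, r, hr⟩ := hr
  let K₀ := Subgroup.closure (Set.range φ ∪ {r})
  have hφK : ∀ g, φ g ∈ K₀ := fun g => Subgroup.subset_closure (Or.inl ⟨g, rfl⟩)
  let φ₀ : G →* K₀ := φ.codRestrict K₀ hφK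
  have hφ₀ : Function.Injective φ₀ := fun a b h => hφ (congrArg Subtype.val h)
  let r₀ : K₀ := ⟨r, Subgroup.subset_closure (Or.inr rfl)⟩
  have hr₀ : r₀ ^ 2 ^ i = φ₀ x := Subtype.ext hr
  have hrc : r₀ ^ 2 ^ n ∈ Subgroup.center K₀ := mem_center_iff_commutatorElement_eq_one.2 fun y =>
    Subtype.ext (pow_mem_center_closure hK hi hx hr y.2)
  have hrn : r₀ ^ 2 ^ (n + i) = 1 := by
    rw [add_comm, pow_add, pow_mul, hr₀, ← map_pow, hxn, map_one]
  obtain ⟨Q, _, ψ, hQ, hψ, w, s, t, hxr, hrw, hw, hs, ht, hws, hwt, hs1, ht1, hst⟩ :=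
    (hK.subgroup K₀).exists_extension_root hrc hrn
  have hpow : ∀ g, ⁅ψ (φ₀ g), ψ r₀ * w⁆ ^ 2 ^ n = 1 := fun g => by
    rw [← hQ.commutator_pow_right, hrw, commutatorElement_one_right]
  let S : Set Q := Set.range (ψ.comp φ₀) ∪ {ψ r₀ * w, s, t}
  let A := Subgroup.closure S
  have hA : IsBurnside (2 ^ (n + 1)) A := by
    have hp : ∀ {a b : Q}, ⁅a, b⁆ ^ 2 ^ n = 1 → ⁅b, a⁆ ^ 2 ^ n = 1 := fun {a b} h => by
      rw [← commutatorElement_inv, inv_pow, h, inv_one]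
    have h1 : ∀ {a b : Q}, ⁅a, b⁆ = 1 → ⁅a, b⁆ ^ 2 ^ n = 1 := fun h => by rw [h, one_pow]
    have hrs : ⁅ψ r₀ * w, s⁆ = 1 := by rw [hQ.commutator_mul_left, hs, hws, one_mul]
    have hrt : ⁅ψ r₀ * w, t⁆ = 1 := by rw [hQ.commutator_mul_left, ht, hwt, one_mul]
    refine hQ.isBurnside_closure ?_ ?_
    · rintro _ (⟨g, rfl⟩ | rfl | rfl | rfl)
      · rw [← map_pow, hb, map_one]
      · rw [pow_succ, pow_mul, hrw, one_pow]
      · exact hs1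
      · exact ht1
    · rintro _ (⟨g, rfl⟩ | rfl | rfl | rfl) _ (⟨g', rfl⟩ | rfl | rfl | rfl)
      · rw [← map_commutatorElement, ← map_pow, hG.commutatorElement_pow hb, map_one]
      · exact hpow g
      · exact h1 (hs _)
      · exact h1 (ht _)
      · exact hp (hpow g')
      · exact h1 (commutatorElement_self _)
      · exact h1 hrs
      · exact h1 hrt
      · exact hp (h1 (hs _))
      · exact hp (h1 hrs)
      · exact h1 (commutatorElement_self _)
      · exact hst
      · exact hp (h1 (ht _))
      · exact hp (h1 hrt)
      · exact hp hst
      · exact h1 (commutatorElement_self _)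
  have hφA : ∀ g, ψ.comp φ₀ g ∈ A := fun g => Subgroup.subset_closure (Or.inl ⟨g, rfl⟩)
  let a : A := ⟨ψ r₀ * w, Subgroup.subset_closure (Or.inr (Or.inl rfl))⟩
  let s' : A := ⟨s, Subgroup.subset_closure (Or.inr (Or.inr (Or.inl rfl)))⟩
  let t' : A := ⟨t, Subgroup.subset_closure (Or.inr (Or.inr (Or.inr rfl)))⟩
  refine ⟨A, inferInstance, (ψ.comp φ₀).codRestrict A hφA, hQ.subgroup A, hA,
    fun g g' h => hφ₀ (hψ (congrArg Subtype.val h)), a, ⁅s', t'⁆,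
    commutatorElement_mem_commutator _ _, Subtype.ext ?_⟩
  change ψ (φ₀ x) = (ψ r₀ * w) ^ 2 ^ i * ⁅s, t⁆
  rw [← hr₀, hxr]

end Necessity

/-! ### The pairing between the two groups of an amalgam -/

section Pairing

/-- The commutator of two elements of a group of class two, as an element of the center. -/
def IsNilTwo.centralCommutator {G : Type u} [Group G] (h : IsNilTwo G) (a b : G) :
    Subgroup.center G :=
  ⟨⁅a, b⁆, h.commutatorElement_mem_center a b⟩

variable {B : Type u} {A : Type v} {C : Type w} [Group B] [Group A] [Group C]

/-- A map of two variables to an abelian group that is a homomorphism in each variable factors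
through the abelianizations. -/
theorem exists_bilinear_of_bihom {W : Type*} [AddCommGroup W] (c : A →* C →* Multiplicative W) :
    ∃ f : Additive (Abelianization A) →ₗ[ℤ] Additive (Abelianization C) →ₗ[ℤ] W,
      ∀ x y, f (Additive.ofMul (Abelianization.of x)) (Additive.ofMul (Abelianization.of y)) =
        (c x y).toAdd := by
  let L : Abelianization A →* Abelianization C →* Multiplicative W :=
    Abelianization.lift (MonoidHom.mk' (fun a => Abelianization.lift (c a)) fun a b =>
      Abelianization.hom_ext _ _ (by ext x; simp))
  refine ⟨(AddMonoidHom.mk' (fun x => (MonoidHom.toAdditiveLeft (L x.toMul)).toIntLinearMap)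
    fun x y => ?_).toIntLinearMap, fun x y => ?_⟩
  · ext z
    simp
  · simp [L]

theorem exists_bihom_of_bilinear {W : Type*} [AddCommGroup W]
    (f : Additive (Abelianization A) →ₗ[ℤ] Additive (Abelianization C) →ₗ[ℤ] W) :
    ∃ c : A →* C →* Multiplicative W, ∀ x y, (c x y).toAdd =
      f (Additive.ofMul (Abelianization.of x)) (Additive.ofMul (Abelianization.of y)) := by
  refine ⟨MonoidHom.mk' (fun a => MonoidHom.mk' (fun c => Multiplicative.ofAdd
    (f (Additive.ofMul (Abelianization.of a)) (Additive.ofMul (Abelianization.of c))))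
    fun x y => ?_) fun x y => ?_, fun x y => rfl⟩
  · simp
  · ext z
    simp

theorem ofMul_of_eq_iff {x y : A} : Additive.ofMul (Abelianization.of x) =
    Additive.ofMul (Abelianization.of y) ↔ ∃ c ∈ commutator A, y = x * c := by
  rw [Additive.ofMul.apply_eq_iff_eq]
  refine QuotientGroup.eq.trans ⟨fun h => ⟨_, h, (mul_inv_cancel_left x y).symm⟩, ?_⟩
  rintro ⟨c, hc, rfl⟩
  rwa [inv_mul_cancel_left]

open scoped IsMulCommutative in
/-- The centers of the two groups of an amalgam embed in an injective abelian group, in such a way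
that exactly the elements of the core that are central in both groups are identified. -/
theorem exists_baer_amalgam_center (Φ₁ : B →* A) (Φ₂ : B →* C) :
    ∃ (W : Type max v w) (_ : AddCommGroup W) (ιA : Subgroup.center A →* Multiplicative W)
      (ιC : Subgroup.center C →* Multiplicative W), Module.Baer ℤ W ∧
        ∀ x y, ιA x = ιC y ↔ ∃ b, Φ₁ b = x ∧ Φ₂ b = y := by
  -- Dividing by `R` gives the pushout of the two centers over the elements of the core that are
  -- central on both sides.
  let R : Subgroup (Subgroup.center A × Subgroup.center C) :=
    { carrier := {p | ∃ b, Φ₁ b = p.1 ∧ Φ₂ b = (p.2⁻¹ : Subgroup.center C)}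
      one_mem' := ⟨1, by simp, by simp⟩
      mul_mem' := by
        rintro p p' ⟨b, h1, h2⟩ ⟨b', h1', h2'⟩
        refine ⟨b * b', by rw [map_mul, h1, h1']; rfl, ?_⟩
        rw [map_mul, h2, h2', Prod.snd_mul, mul_inv]
        rfl
      inv_mem' := by
        rintro p ⟨b, h1, h2⟩
        exact ⟨b⁻¹, by rw [map_inv, h1]; rfl, by rw [map_inv, h2]; rfl⟩ }
  obtain ⟨W, _, ι, hι, hW⟩ :=
    exists_injective_hom_baer (Additive ((Subgroup.center A × Subgroup.center C) ⧸ R))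
  let κ : (Subgroup.center A × Subgroup.center C) ⧸ R →* Multiplicative W :=
    AddMonoidHom.toMultiplicativeRight ι
  have hκ : Function.Injective κ := fun x y h => hι h
  refine ⟨W, inferInstance, κ.comp ((QuotientGroup.mk' R).comp (MonoidHom.inl _ _)),
    κ.comp ((QuotientGroup.mk' R).comp (MonoidHom.inr _ _)), hW, fun x y => ?_⟩
  refine (hκ.eq_iff (a := QuotientGroup.mk' R (MonoidHom.inl _ _ x))
    (b := QuotientGroup.mk' R (MonoidHom.inr _ _ y))).trans
      (eq_comm.trans (QuotientGroup.eq.trans ?_))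
  have e : (MonoidHom.inr (Subgroup.center A) (Subgroup.center C) y)⁻¹ *
      MonoidHom.inl (Subgroup.center A) (Subgroup.center C) x = (x, y⁻¹) := by
    ext <;> simp
  rw [e]
  change (∃ b, Φ₁ b = x ∧ Φ₂ b = (y⁻¹⁻¹ : Subgroup.center C)) ↔ _
  rw [inv_inv]

/-- The obstruction to strong embeddability: if the commutators with the core are compatible on
roots of elements of the core, then they extend to a pairing of the two groups. -/
theorem exists_pairing (hA : IsNilTwo A) (hC : IsNilTwo C) (Φ₁ : B →* A) (Φ₂ : B →* C)
    (h : ∀ (q : ℤ) (a : A) (c : C) (b d : B), (∃ α ∈ commutator A, Φ₁ b = a ^ q * α) →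
      (∃ γ ∈ commutator C, Φ₂ d = c ^ q * γ) → ∃ z, Φ₁ z = ⁅a, Φ₁ d⁆ ∧ Φ₂ z = ⁅Φ₂ b, c⁆) :
    ∃ (V : Type max v w) (_ : CommGroup V) (ιA : Subgroup.center A →* V)
      (ιC : Subgroup.center C →* V) (β : A →* C →* V),
      (∀ a b, β a (Φ₂ b) = ιA (hA.centralCommutator a (Φ₁ b))) ∧
      (∀ b c, β (Φ₁ b) c = ιC (hC.centralCommutator (Φ₂ b) c)) ∧
      ∀ x y, ιA x = ιC y → ∃ b, Φ₁ b = x ∧ Φ₂ b = y := by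
  obtain ⟨W, _, ιA, ιC, hW, hι⟩ := exists_baer_amalgam_center Φ₁ Φ₂
  obtain ⟨f, hf⟩ := exists_bilinear_of_bihom (A := A) (C := B)
    (MonoidHom.mk' (fun a => MonoidHom.mk' (fun b => ιA (hA.centralCommutator a (Φ₁ b)))
      fun b b' => by
        rw [← map_mul]
        exact congrArg ιA (Subtype.ext (by
          rw [map_mul]; exact hA.commutator_mul_right a (Φ₁ b) (Φ₁ b'))))
      fun a a' => MonoidHom.ext fun b => (congrArg ιA (Subtype.ext
        (hA.commutator_mul_left a a' (Φ₁ b)))).trans (map_mul ιA (hA.centralCommutator a (Φ₁ b))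
          (hA.centralCommutator a' (Φ₁ b))))
  obtain ⟨g, hg⟩ := exists_bilinear_of_bihom (A := B) (C := C)
    (MonoidHom.mk' (fun b => MonoidHom.mk' (fun c => ιC (hC.centralCommutator (Φ₂ b) c))
      fun c c' => by
        rw [← map_mul]
        exact congrArg ιC (Subtype.ext (hC.commutator_mul_right (Φ₂ b) c c')))
      fun b b' => MonoidHom.ext fun c => (congrArg ιC (Subtype.ext (by
        rw [map_mul]; exact hC.commutator_mul_left (Φ₂ b) (Φ₂ b') c))).trans
          (map_mul ιC (hC.centralCommutator (Φ₂ b) c) (hC.centralCommutator (Φ₂ b') c)))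
  -- On abelianizations, `q • x = i b` reads `Φ₁ b = a ^ q` modulo commutators, so `h` is the
  -- compatibility condition.
  obtain ⟨β, hβ1, hβ2⟩ := exists_bilinear_extension hW
    (Abelianization.map Φ₁).toAdditive.toIntLinearMap
    (Abelianization.map Φ₂).toAdditive.toIntLinearMap f g (by
      intro q x y b d hx hy
      induction x using Additive.rec with | ofMul x => ?_
      induction y using Additive.rec with | ofMul y => ?_
      induction b using Additive.rec with | ofMul b => ?_
      induction d using Additive.rec with | ofMul d => ?_
      obtain ⟨a, rfl⟩ := QuotientGroup.mk_surjective x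
      obtain ⟨c, rfl⟩ := QuotientGroup.mk_surjective y
      obtain ⟨b, rfl⟩ := QuotientGroup.mk_surjective b
      obtain ⟨d, rfl⟩ := QuotientGroup.mk_surjective d
      obtain ⟨z, hz1, hz2⟩ := h q a c b d (ofMul_of_eq_iff.1 (by rw [map_zpow]; exact hx))
        (ofMul_of_eq_iff.1 (by rw [map_zpow]; exact hy))
      refine (hf a d).trans (Eq.trans ?_ (hg b c).symm)
      exact congrArg _ ((hι _ _).2 ⟨z, hz1, hz2⟩))
  obtain ⟨c, hc⟩ := exists_bihom_of_bilinear β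
  refine ⟨Multiplicative W, inferInstance, ιA, ιC, c, fun a b => ?_, fun b x => ?_,
    fun x y hxy => (hι x y).1 hxy⟩
  · exact (hc a (Φ₂ b)).trans ((hβ1 _ (Additive.ofMul (Abelianization.of b))).trans (hf a b))
  · exact (hc (Φ₁ b) x).trans ((hβ2 (Additive.ofMul (Abelianization.of b)) _).trans (hg b x))

end Pairing

/-! ### The amalgam inside a quotient of the twisted product -/

section Embedding

variable {B A C V : Type u} [Group B] [Group A] [Group C] [CommGroup V]

theorem bihom_left_eq_one (β : A →* C →* V) {a : A} (ha : a ∈ commutator A) (c : C) :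
    β a c = 1 :=
  Abelianization.commutator_subset_ker (β.flip c) ha

theorem bihom_right_eq_one (β : A →* C →* V) {c : C} (hc : c ∈ commutator C) (a : A) :
    β a c = 1 :=
  Abelianization.commutator_subset_ker (β a) hc

/-- This is the twist met on multiplying two elements of `amalgamSubgroup`; being a commutator of
the core, it can be absorbed into the `C'`-part. -/
theorem pairing_apply (hC : IsNilTwo C) (Φ₁ : B →* A) (Φ₂ : B →* C)
    (ιC : Subgroup.center C →* V) (β : A →* C →* V)
    (h2 : ∀ b c, β (Φ₁ b) c = ιC (hC.centralCommutator (Φ₂ b) c)) (b b' : B) {α : A}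
    (hα : α ∈ commutator A) {γ : C} (hγ : γ ∈ commutator C) :
    β (Φ₁ b * α) ((Φ₂ b')⁻¹ * γ) = ιC (hC.centralCommutator (Φ₂ b') (Φ₂ b)) := by
  rw [map_mul β, MonoidHom.mul_apply, bihom_left_eq_one β hα, map_mul, bihom_right_eq_one β hγ, h2,
    mul_one, mul_one]
  refine congrArg ιC (Subtype.ext ?_)
  change ⁅Φ₂ b, (Φ₂ b')⁻¹⁆ = ⁅Φ₂ b', Φ₂ b⁆
  rw [← zpow_neg_one, hC.commutator_zpow_right, zpow_neg_one, commutatorElement_inv]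

/-- The subgroup of the twisted product by which one divides to identify the two copies of the
core, and the values of the pairing with commutators. -/
def amalgamSubgroup (hC : IsNilTwo C) (Φ₁ : B →* A) (Φ₂ : B →* C)
    (ιA : Subgroup.center A →* V) (ιC : Subgroup.center C →* V) (β : A →* C →* V)
    (h2 : ∀ b c, β (Φ₁ b) c = ιC (hC.centralCommutator (Φ₂ b) c)) :
    Subgroup (TwistedProduct β) where
  -- The factor `b` identifies `Φ₁ b` with `Φ₂ b`; `α` and `γ` identify elements of `A'` and `C'`
  -- with their images in `V`.
  carrier := {x | ∃ (b : B) (α : Subgroup.center A) (γ : Subgroup.center C),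
    (α : A) ∈ commutator A ∧ (γ : C) ∈ commutator C ∧
      x = ⟨Φ₁ b * α, (Φ₂ b)⁻¹ * γ, (ιA α * ιC γ)⁻¹⟩}
  one_mem' := ⟨1, 1, 1, one_mem _, one_mem _, by ext <;> simp [TwistedProduct.one_def]⟩
  mul_mem' := by
    rintro _ _ ⟨b, α, γ, hα, hγ, rfl⟩ ⟨b', α', γ', hα', hγ', rfl⟩
    refine ⟨b * b', α * α', hC.centralCommutator (Φ₂ b) (Φ₂ b') * (γ * γ'), mul_mem hα hα',
      mul_mem (commutatorElement_mem_commutator _ _) (mul_mem hγ hγ'), ?_⟩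
    ext
    · have e := Subgroup.mem_center_iff.1 α.2 (Φ₁ b')
      simp only [TwistedProduct.mul_def, map_mul, Subgroup.coe_mul]
      rw [mul_assoc, ← mul_assoc (α : A), ← e]
      simp only [mul_assoc]
    · have e := Subgroup.mem_center_iff.1 γ.2 (Φ₂ b')⁻¹
      simp only [TwistedProduct.mul_def, Subgroup.coe_mul]
      rw [mul_assoc, ← mul_assoc (γ : C), ← e, ← mul_assoc _ _ ((γ : C) * γ')]
      change _ = (Φ₂ (b * b'))⁻¹ * ⁅Φ₂ b, Φ₂ b'⁆ * _
      rw [commutatorElement_def, map_mul]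
      group
    · simp only [TwistedProduct.mul_def, pairing_apply hC Φ₁ Φ₂ ιC β h2 b' b hα' hγ]
      simp only [map_mul, mul_inv_rev]
      simp only [mul_comm, mul_left_comm, mul_assoc]
  inv_mem' := by
    rintro _ ⟨b, α, γ, hα, hγ, rfl⟩
    refine ⟨b⁻¹, α⁻¹, γ⁻¹, inv_mem hα, inv_mem hγ, ?_⟩
    ext
    · have e := Subgroup.mem_center_iff.1 (inv_mem α.2) (Φ₁ b)⁻¹
      simp only [TwistedProduct.inv_def, map_inv, Subgroup.coe_inv, mul_inv_rev]
      exact e.symm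
    · have e := Subgroup.mem_center_iff.1 (inv_mem γ.2) (Φ₂ b)
      simp only [TwistedProduct.inv_def, map_inv, Subgroup.coe_inv, mul_inv_rev, inv_inv]
      exact e.symm
    · have e : ιC (hC.centralCommutator (Φ₂ b) (Φ₂ b)) = 1 := by
        rw [← map_one ιC]
        exact congrArg ιC (Subtype.ext (commutatorElement_self _))
      simp only [TwistedProduct.inv_def, pairing_apply hC Φ₁ Φ₂ ιC β h2 b b hα hγ, e]
      simp [mul_comm]

/-- The commutator of an arbitrary element with a member of the subgroup is the element `y` below,
itself a member: `h1` and `h2` make its `V`-component match its components in `A'` and `C'`. -/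
theorem amalgamSubgroup_normal (hA : IsNilTwo A) (hC : IsNilTwo C) (Φ₁ : B →* A) (Φ₂ : B →* C)
    (ιA : Subgroup.center A →* V) (ιC : Subgroup.center C →* V) (β : A →* C →* V)
    (h1 : ∀ a b, β a (Φ₂ b) = ιA (hA.centralCommutator a (Φ₁ b)))
    (h2 : ∀ b c, β (Φ₁ b) c = ιC (hC.centralCommutator (Φ₂ b) c)) :
    (amalgamSubgroup hC Φ₁ Φ₂ ιA ιC β h2).Normal := by
  refine ⟨?_⟩
  rintro _ ⟨b, α, γ, hα, hγ, rfl⟩ ⟨a, c, w⟩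
  let x : TwistedProduct β := ⟨Φ₁ b * α, (Φ₂ b)⁻¹ * γ, (ιA α * ιC γ)⁻¹⟩
  let α' := hA.centralCommutator a (Φ₁ b)
  let γ' := hC.centralCommutator (Φ₂ b) c
  let y : TwistedProduct β := ⟨Φ₁ 1 * α', (Φ₂ 1)⁻¹ * γ', (ιA α' * ιC γ')⁻¹⟩
  have hα' : (α' : A) ∈ commutator A := commutatorElement_mem_commutator _ _
  have hγ' : (γ' : C) ∈ commutator C := commutatorElement_mem_commutator _ _
  have hy : y ∈ amalgamSubgroup hC Φ₁ Φ₂ ιA ιC β h2 := ⟨1, α', γ', hα', hγ', rfl⟩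
  have hx : x ∈ amalgamSubgroup hC Φ₁ Φ₂ ιA ιC β h2 := ⟨b, α, γ, hα, hγ, rfl⟩
  suffices e : (⟨a, c, w⟩ : TwistedProduct β) * x = y * x * ⟨a, c, w⟩ by
    change ⟨a, c, w⟩ * x * _ ∈ _
    rw [e, mul_inv_cancel_right]
    exact mul_mem hy hx
  ext
  · have e := Subgroup.mem_center_iff.1 α.2 a
    simp only [TwistedProduct.mul_def, x, y, map_one, one_mul]
    change a * (Φ₁ b * α) = ⁅a, Φ₁ b⁆ * (Φ₁ b * α) * a
    rw [mul_assoc, mul_assoc, ← e, commutatorElement_def]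
    group
  · have e := Subgroup.mem_center_iff.1 γ.2 c
    have e' := Subgroup.mem_center_iff.1 (hC.commutatorElement_mem_center (Φ₂ b) c) (Φ₂ b)⁻¹
    simp only [TwistedProduct.mul_def, x, y, map_one, one_mul, inv_one]
    change c * ((Φ₂ b)⁻¹ * γ) = ⁅Φ₂ b, c⁆ * ((Φ₂ b)⁻¹ * γ) * c
    rw [← mul_assoc ⁅Φ₂ b, c⁆, ← e', mul_assoc, mul_assoc, ← e, commutatorElement_def]
    group
  · have e1 : β (Φ₁ b * α) c = ιC γ' := by
      rw [map_mul, MonoidHom.mul_apply, bihom_left_eq_one β hα, mul_one, h2]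
    have e2 : β (Φ₁ b * α) ((Φ₂ 1)⁻¹ * γ') = 1 := by
      rw [map_one, inv_one, one_mul, bihom_right_eq_one β hγ']
    have e3 : β a ((Φ₂ 1)⁻¹ * γ' * ((Φ₂ b)⁻¹ * γ)) = (ιA α')⁻¹ := by
      rw [map_one, inv_one, one_mul, map_mul, map_mul, bihom_right_eq_one β hγ',
        bihom_right_eq_one β hγ, map_inv, h1, one_mul, mul_one]
    simp only [TwistedProduct.mul_def, x, y, e1, e2, e3, mul_inv_rev, inv_inv, inv_one, mul_one]
    rw [show (ιC γ')⁻¹ * (ιA α')⁻¹ * ((ιC γ)⁻¹ * (ιA α)⁻¹) * w * ιA α' =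
      w * ((ιC γ)⁻¹ * (ιA α)⁻¹) * (ιC γ')⁻¹ * ((ιA α')⁻¹ * ιA α') by
        simp only [mul_comm, mul_left_comm, mul_assoc]]
    rw [inv_mul_cancel, mul_one]

/-- Everything rests on `hmem`: if `(a, c, 1)` is divided out, then `α⁻¹` and `γ` agree in `V`,
hence by `h3` come from one element of the core, and so do `a` and `c⁻¹`. -/
theorem stronglyEmbeddable_of_pairing (hA : IsNilTwo A) (hC : IsNilTwo C) {Φ₁ : B →* A}
    {Φ₂ : B →* C} (hΦ₁ : Function.Injective Φ₁) (hΦ₂ : Function.Injective Φ₂)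
    (ιA : Subgroup.center A →* V) (ιC : Subgroup.center C →* V) (β : A →* C →* V)
    (h1 : ∀ a b, β a (Φ₂ b) = ιA (hA.centralCommutator a (Φ₁ b)))
    (h2 : ∀ b c, β (Φ₁ b) c = ιC (hC.centralCommutator (Φ₂ b) c))
    (h3 : ∀ x y, ιA x = ιC y → ∃ b, Φ₁ b = x ∧ Φ₂ b = y) : StronglyEmbeddable Φ₁ Φ₂ := by
  let N := amalgamSubgroup hC Φ₁ Φ₂ ιA ιC β h2
  have hN : N.Normal := amalgamSubgroup_normal hA hC Φ₁ Φ₂ ιA ιC β h1 h2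
  have hmem : ∀ a c, (⟨a, c, 1⟩ : TwistedProduct β) ∈ N → ∃ b, a = Φ₁ b ∧ c = (Φ₂ b)⁻¹ := by
    rintro a c ⟨b, α, γ, -, -, h⟩
    have ha : a = Φ₁ b * α := congrArg TwistedProduct.fst h
    have hc : c = (Φ₂ b)⁻¹ * γ := congrArg TwistedProduct.snd h
    have hv : 1 = (ιA α * ιC γ)⁻¹ := congrArg TwistedProduct.val h
    have hv' : ιA α⁻¹ = ιC γ := by
      rw [eq_comm, inv_eq_one] at hv
      rw [map_inv]
      exact inv_eq_of_mul_eq_one_right hv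
    obtain ⟨b', hα, hγ⟩ := h3 _ _ hv'
    refine ⟨b * b'⁻¹, ?_, ?_⟩
    · rw [ha, map_mul, map_inv, hα, Subgroup.coe_inv, inv_inv]
    · rw [hc, map_mul, map_inv, hγ, mul_inv_rev, inv_inv]
      exact Subgroup.mem_center_iff.1 γ.2 _
  have hl : ∀ a, TwistedProduct.inl β a ∈ N → a = 1 := by
    intro a ha
    obtain ⟨b, hb, hb'⟩ := hmem a 1 ha
    have : b = 1 := hΦ₂ (by rw [map_one]; exact (inv_eq_one.1 hb'.symm))
    rw [hb, this, map_one]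
  have hr : ∀ c, TwistedProduct.inr β c ∈ N → c = 1 := by
    intro c hc
    obtain ⟨b, hb, hb'⟩ := hmem 1 c hc
    have : b = 1 := hΦ₁ (by rw [map_one]; exact hb.symm)
    rw [hb', this, map_one, inv_one]
  have hlr : ∀ a c, (TwistedProduct.inl β a)⁻¹ * TwistedProduct.inr β c = ⟨a⁻¹, c, 1⟩ := by
    intro a c
    rw [← map_inv]
    simp [TwistedProduct.inl, TwistedProduct.inr, TwistedProduct.mul_def]
  have hM := TwistedProduct.isNilTwo (β := β) hA hC
  refine ⟨TwistedProduct β ⧸ N, inferInstance, (QuotientGroup.mk' N).comp (TwistedProduct.inl β),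
    (QuotientGroup.mk' N).comp (TwistedProduct.inr β), ?_, ?_, ?_, ?_, ?_⟩
  · refine isNilTwo_of_commutatorElement_mem_center fun x y => Subgroup.mem_center_iff.2 fun z => ?_
    obtain ⟨x, rfl⟩ := QuotientGroup.mk'_surjective N x
    obtain ⟨y, rfl⟩ := QuotientGroup.mk'_surjective N y
    obtain ⟨z, rfl⟩ := QuotientGroup.mk'_surjective N z
    rw [← map_commutatorElement, ← map_mul, ← map_mul,
      Subgroup.mem_center_iff.1 (hM.commutatorElement_mem_center x y)]
  · exact (injective_iff_map_eq_one _).2 fun a ha => hl a ((QuotientGroup.eq_one_iff _).1 ha)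
  · exact (injective_iff_map_eq_one _).2 fun c hc => hr c ((QuotientGroup.eq_one_iff _).1 hc)
  · refine MonoidHom.ext fun b => QuotientGroup.eq.2 ?_
    rw [hlr]
    exact ⟨b⁻¹, 1, 1, one_mem _, one_mem _, by ext <;> simp⟩
  · intro a ha c _ hac
    have h : (TwistedProduct.inl β a)⁻¹ * TwistedProduct.inr β c ∈ N := QuotientGroup.eq.1 hac
    rw [hlr] at h
    obtain ⟨b, hb, -⟩ := hmem _ _ h
    exact ha ⟨b⁻¹, by rw [map_inv, ← hb, inv_inv]⟩

end Embedding

/-! ### Sufficiency: from the root condition to strong embeddability -/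

section Sufficiency

variable {B A C : Type u} [Group B] [Group A] [Group C] {n : ℕ}

/-- Modulo commutators, a root exists in some extension of class two. -/
theorem hasRootInExtension_of_eq_pow_mul (hA : IsNilTwo A) {Φ : B →* A}
    (hΦ : Function.Injective Φ) {m : ℕ} (hm : 0 < m) {x : B} {a c : A} (hc : c ∈ commutator A)
    (hx : Φ x = a ^ m * c) : HasRootInExtension m x := by
  -- A central `m`-th root of `c` is adjoined; multiplying `a` by it gives a root of `x`.
  obtain ⟨Q, _, α, β, hα, hcomm, hs, hz⟩ := exists_centralProduct (H := Multiplicative ℤ)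
    (w := Multiplicative.ofAdd (m : ℤ)) (hA hc)
    (Subgroup.mem_center_iff.2 fun g => mul_comm g _) (fun k hk => by
      have h : k * (m : ℤ) = 0 := hk
      have hk0 : k = 0 := by
        rcases mul_eq_zero.1 h with h | h
        · exact h
        · omega
      rw [hk0, zpow_zero])
  refine ⟨Q, inferInstance, α.comp Φ,
    isNilTwo_of_commuting_generators hA (isNilTwo_of_commGroup _) hcomm hs, hα.comp hΦ,
    α a * β (Multiplicative.ofAdd 1), ?_⟩
  rw [(hcomm _ _).mul_pow, MonoidHom.comp_apply, hx, map_mul, hz, ← map_pow, ← map_pow]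
  congr 2
  rw [← ofAdd_nsmul]
  simp

/-- The condition on the core of an amalgam that characterizes embeddability. -/
def RootCondition (n : ℕ) (G : Type u) [Group G] : Prop :=
  ∀ (x : G) (i : ℕ), 1 ≤ i → i ≤ n - 1 →
    x ∈ powComm G (2 ^ i) ∨ x ^ 2 ^ (n - i) ∉ Subgroup.center G ∨ x ^ 2 ^ n ≠ 1 ∨
      ¬ HasRootInExtension (2 ^ i) x

theorem mem_center_of_map {Φ : B →* A} (hΦ : Function.Injective Φ) {x : B}
    (hx : Φ x ∈ Subgroup.center A) : x ∈ Subgroup.center B :=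
  Subgroup.mem_center_iff.2 fun b => hΦ (by
    rw [map_mul, map_mul, Subgroup.mem_center_iff.1 hx])

/-- The closure property, derived from (iii). The exponent of `A` rules out alternatives (b) and
(c), and `hasRootInExtension_of_eq_pow_mul` rules out (d). The extreme cases are `i = 0`, which is
trivial, and `i = n`, which is `hΩ`. -/
theorem RootCondition.mem_powComm (h : RootCondition n B) (hn : 0 < n)
    (hΩ : ∀ x : B, x ∈ Subgroup.center B → x ^ 2 ^ n = 1 → x ∈ powComm B (2 ^ n))
    (hA : IsNilTwo A) (hbA : IsBurnside (2 ^ (n + 1)) A) {Φ : B →* A}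
    (hΦ : Function.Injective Φ) {i : ℕ} (hi : i ≤ n) {x : B} {a c : A} (hc : c ∈ commutator A)
    (hx : Φ x = a ^ 2 ^ i * c) : x ∈ powComm B (2 ^ i) := by
  have key : x ^ 2 ^ (n - i) ∈ Subgroup.center B := by
    refine mem_center_of_map hΦ ?_
    rw [map_pow, hx, hA.mul_pow_of_mem_commutator hc, ← pow_mul, ← pow_add, Nat.add_sub_cancel' hi]
    exact mul_mem (hA.pow_mem_center hbA a) (Subgroup.pow_mem _ (hA hc) _)
  have key' : 1 ≤ i → x ^ 2 ^ n = 1 := by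
    intro hi1
    refine hΦ ?_
    obtain ⟨j, rfl⟩ : ∃ j, i = j + 1 := ⟨i - 1, by omega⟩
    rw [map_pow, hx, hA.mul_pow_of_mem_commutator hc, hA.commutator_pow_eq_one hbA hc, mul_one,
      ← pow_mul, ← pow_add, show j + 1 + n = n + 1 + j by omega, pow_add 2 (n + 1) j, pow_mul, hbA,
      one_pow, map_one]
  rcases Nat.eq_zero_or_pos i with rfl | hi1
  · exact Subgroup.mem_sup_left (Subgroup.subset_closure ⟨x, by simp⟩)
  rcases hi.eq_or_lt with rfl | hin
  · exact hΩ x (by simpa using key) (key' hi1)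
  · rcases h x i hi1 (by omega) with h | h | h | h
    · exact h
    · exact (h key).elim
    · exact (h (key' hi1)).elim
    · exact (h (hasRootInExtension_of_eq_pow_mul hA hΦ (by positivity) hc hx)).elim

theorem IsNilTwo.map_mem_center_of_mem_powComm (hB : IsNilTwo B) (hA : IsNilTwo A)
    (hbA : IsBurnside (2 ^ (n + 1)) A) (Φ : B →* A) {x : B} (hx : x ∈ powComm B (2 ^ n)) :
    Φ x ∈ Subgroup.center A := by
  obtain ⟨a, c, hc, rfl⟩ := hB.mem_powComm_iff.1 hx
  rw [map_mul, map_pow]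
  exact mul_mem (hA.pow_mem_center hbA _) (hA (map_mem_commutator Φ hc))

theorem IsNilTwo.commutatorElement_mul_right_of_mem (hA : IsNilTwo A) {c : A}
    (hc : c ∈ commutator A) (a b : A) : ⁅a, b * c⁆ = ⁅a, b⁆ := by
  rw [hA.commutator_mul_right, commutatorElement_eq_one_of_mem_center_right (hA hc), mul_one]

theorem IsNilTwo.commutatorElement_mul_left_of_mem (hA : IsNilTwo A) {c : A}
    (hc : c ∈ commutator A) (a b : A) : ⁅a * c, b⁆ = ⁅a, b⁆ := by
  rw [hA.commutator_mul_left, commutatorElement_eq_one_of_mem_center_left (hA hc), mul_one]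

/-- Only `2 ^ i = gcd (q, 2 ^ (n + 1))` matters. If `i ≤ n`, closure gives `b ≡ b₀ ^ q` and `d ≡ d₀
^ q` in the core, and `z = ⁅b, d₀⁆ = ⁅b₀, d⁆` serves both sides. -/
theorem RootCondition.exists_eq_commutatorElement (h : RootCondition n B) (hn : 0 < n)
    (hB : IsNilTwo B) (hbB : IsBurnside (2 ^ (n + 1)) B)
    (hΩ : ∀ x : B, x ∈ Subgroup.center B → x ^ 2 ^ n = 1 → x ∈ powComm B (2 ^ n))
    (hA : IsNilTwo A) (hbA : IsBurnside (2 ^ (n + 1)) A)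
    (hC : IsNilTwo C) (hbC : IsBurnside (2 ^ (n + 1)) C) {Φ₁ : B →* A} {Φ₂ : B →* C}
    (hΦ₁ : Function.Injective Φ₁) (hΦ₂ : Function.Injective Φ₂)
    (q : ℤ) (a : A) (c : C) (b d : B) (hb : ∃ α ∈ commutator A, Φ₁ b = a ^ q * α)
    (hd : ∃ γ ∈ commutator C, Φ₂ d = c ^ q * γ) :
    ∃ z, Φ₁ z = ⁅a, Φ₁ d⁆ ∧ Φ₂ z = ⁅Φ₂ b, c⁆ := by
  obtain ⟨α, hα, hb⟩ := hb
  obtain ⟨γ, hγ, hd⟩ := hd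
  obtain ⟨i, hi, hgcd⟩ := (Nat.dvd_prime_pow Nat.prime_two).1
    (Int.gcd_dvd_natAbs_right q ((2 ^ (n + 1) : ℕ) : ℤ))
  have hdvd : ∀ j ≤ i, ∃ m : ℤ, q = m * (2 ^ j : ℕ) := by
    intro j hj
    have h1 : ((2 ^ j : ℕ) : ℤ) ∣ q := by
      refine dvd_trans ?_ (Int.gcd_dvd_left q ((2 ^ (n + 1) : ℕ) : ℤ))
      rw [hgcd]
      exact_mod_cast pow_dvd_pow 2 hj
    obtain ⟨m, hm⟩ := h1
    exact ⟨m, by rw [hm, mul_comm]⟩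
  have hmem : ∀ j ≤ i, j ≤ n → b ∈ powComm B (2 ^ j) ∧ d ∈ powComm B (2 ^ j) := by
    intro j hj hjn
    obtain ⟨m, rfl⟩ := hdvd j hj
    rw [zpow_mul, zpow_natCast] at hb hd
    exact ⟨h.mem_powComm hn hΩ hA hbA hΦ₁ hjn hα hb, h.mem_powComm hn hΩ hC hbC hΦ₂ hjn hγ hd⟩
  rcases le_or_gt i n with hin | hin
  · obtain ⟨hb', hd'⟩ := hmem i le_rfl hin
    -- Bézout modulo the exponent `2 ^ (n + 1)` turns `2 ^ i`-th powers into `q`-th powers.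
    have hbez : ∃ s : ℤ, ∀ x : B, x ^ 2 ^ i = (x ^ s) ^ q := by
      refine ⟨Int.gcdA q (2 ^ (n + 1) : ℕ), fun x => ?_⟩
      have e := Int.gcd_eq_gcd_ab q (2 ^ (n + 1) : ℕ)
      rw [hgcd] at e
      rw [← zpow_natCast, e, zpow_add, zpow_mul x ((2 ^ (n + 1) : ℕ) : ℤ), zpow_natCast, hbB,
        one_zpow, mul_one, ← zpow_mul, mul_comm]
    obtain ⟨s, hs⟩ := hbez
    obtain ⟨b₀, k, hk, hbk⟩ := hB.mem_powComm_iff.1 hb'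
    obtain ⟨d₀, l, hl, hdl⟩ := hB.mem_powComm_iff.1 hd'
    rw [hs] at hbk hdl
    generalize b₀ ^ s = b₀ at hbk
    generalize d₀ ^ s = d₀ at hdl
    refine ⟨⁅b, d₀⁆, ?_, ?_⟩
    · rw [hdl, map_mul, hA.commutatorElement_mul_right_of_mem (map_mem_commutator _ hl), map_zpow,
        hA.commutator_zpow_right, ← hA.commutator_zpow_left, map_commutatorElement, hb,
        hA.commutatorElement_mul_left_of_mem hα]
    · have e : ⁅b, d₀⁆ = ⁅b₀, d⁆ := by
        rw [hbk, hdl, hB.commutatorElement_mul_left_of_mem hk,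
          hB.commutatorElement_mul_right_of_mem hl, hB.commutator_zpow_left,
          hB.commutator_zpow_right]
      rw [e, map_commutatorElement, hd, hC.commutatorElement_mul_right_of_mem hγ, hbk, map_mul,
        hC.commutatorElement_mul_left_of_mem (map_mem_commutator _ hk), map_zpow,
        hC.commutator_zpow_left, hC.commutator_zpow_right]
  -- Now `b` and `d` lie in `B ^ (2 ^ n) B'`, whose image is central in `A` and in `C`, not merely
  -- in the core; both commutators vanish.
  · obtain ⟨hb', hd'⟩ := hmem n hin.le le_rfl
    refine ⟨1, ?_, ?_⟩
    · rw [map_one, commutatorElement_eq_one_of_mem_center_right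
        (hB.map_mem_center_of_mem_powComm hA hbA Φ₁ hd')]
    · rw [map_one, commutatorElement_eq_one_of_mem_center_left
        (hB.map_mem_center_of_mem_powComm hC hbC Φ₂ hb')]

theorem RootCondition.allAmalgamsStrong (h : RootCondition n B) (hn : 0 < n)
    (hB : IsNilTwo B) (hbB : IsBurnside (2 ^ (n + 1)) B)
    (hΩ : ∀ x : B, x ∈ Subgroup.center B → x ^ 2 ^ n = 1 → x ∈ powComm B (2 ^ n)) :
    AllAmalgamsStrong (2 ^ (n + 1)) B := by
  intro A C _ _ Φ₁ Φ₂ hA hbA hC hbC hΦ₁ hΦ₂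
  obtain ⟨V, _, ιA, ιC, β, h1, h2, h3⟩ := exists_pairing hA hC Φ₁ Φ₂
    (h.exists_eq_commutatorElement hn hB hbB hΩ hA hbA hC hbC hΦ₁ hΦ₂)
  exact stronglyEmbeddable_of_pairing hA hC hΦ₁ hΦ₂ ιA ιC β h1 h2 h3

end Sufficiency

/-! ### The equivalence -/

theorem image_Omega_center_eq_iff {G : Type u} [Group G] (hG : IsNilTwo G) {n : ℕ} (hn : 0 < n)
    (hb : IsBurnside (2 ^ (n + 1)) G) :
    Subtype.val '' Omega n (Subgroup.center G) = (powComm G (2 ^ n) : Set G) ↔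
      ∀ x : G, x ∈ Subgroup.center G → x ^ 2 ^ n = 1 → x ∈ powComm G (2 ^ n) := by
  refine ⟨fun h x hx hxn => ?_, fun h => Set.Subset.antisymm ?_ fun x hx => ?_⟩
  · have : x ∈ Subtype.val '' Omega n (Subgroup.center G) := ⟨⟨x, hx⟩, Subtype.ext hxn, rfl⟩
    rwa [h] at this
  · rintro _ ⟨x, hx, rfl⟩
    exact h x x.2 (congrArg Subtype.val hx)
  · obtain ⟨hx, hxn⟩ := hG.powComm_subset hn hb hx
    exact ⟨⟨x, hx⟩, Subtype.ext hxn, rfl⟩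

end NilTwo

theorem mainTheorem7 (n : ℕ) (hn : 0 < n) (G : Type*) [Group G]
    (hG : NilTwo.IsNilTwo G) (hexp : NilTwo.IsBurnside (2 ^ (n + 1)) G) :
    List.TFAE [
      NilTwo.AllAmalgamsWeak (2 ^ (n + 1)) G,
      NilTwo.AllAmalgamsStrong (2 ^ (n + 1)) G,
      (Subtype.val '' NilTwo.Omega n (Subgroup.center G) = (NilTwo.powComm G (2 ^ n) : Set G)) ∧
        ∀ (x : G) (i : ℕ), 1 ≤ i → i ≤ n - 1 →
          x ∈ NilTwo.powComm G (2 ^ i) ∨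
          x ^ (2 ^ (n - i)) ∉ Subgroup.center G ∨
          x ^ (2 ^ n) ≠ 1 ∨
          ¬ NilTwo.HasRootInExtension (2 ^ i) x] := by
  rw [NilTwo.image_Omega_center_eq_iff hG hn hexp]
  tfae_have 2 → 1 := by
    intro h K₁ K₂ _ _ Φ₁ Φ₂ h1 h2 h3 h4 h5 h6
    obtain ⟨M, _, lA, lC, hM, hA, hC, hl, -⟩ := h K₁ K₂ Φ₁ Φ₂ h1 h2 h3 h4 h5 h6
    exact ⟨M, inferInstance, lA, lC, hM, hA, hC, hl⟩
  tfae_have 3 → 2 := fun ⟨hΩ, h⟩ => NilTwo.RootCondition.allAmalgamsStrong h hn hG hexp hΩ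
  tfae_have 1 → 3 := by
    intro h
    refine ⟨fun x hx hxn => ?_, fun x i hi hin => ?_⟩
    -- Once `x` is a commutator in `A`, it lies in `A ^ (2 ^ n) A'` with trivial power part, hence
    -- `a := 1`.
    · obtain ⟨A, _, φ, hA, hφ, hbA, s, t, hst, -⟩ := hG.exists_extension_mem_commutator hx hxn
      exact h.mem_powComm hG hexp le_rfl hA (hbA hexp) hφ
        (NilTwo.commutatorElement_mem_commutator s t) (a := 1) (by rw [hst, one_pow, one_mul])
    · by_contra! hcon
      obtain ⟨hx, hxc, hxn, hr⟩ := hcon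
      obtain ⟨A, _, φ, hA, hbA, hφ, a, c, hc, hac⟩ :=
        hG.exists_burnside_extension_root hexp (show i ≤ n by omega) hxc hxn hr
      exact hx (h.mem_powComm hG hexp (by omega) hA hbA hφ hc hac)
  tfae_finish
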